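/- Let $(\mathcal X,d)$ be a finite metric space with $N$ points and diameter $\mathrm{diam}(\mathcal X)$, let $p\ge 1$ be real, and let $r,s$ be probability measures on $\mathcal X$, given by their weight vectors $(r_x)_{x\in\mathcal X}$ and $(s_x)_{x\in\mathcal X}$. For probability measures $\mu,\nu$ on $\mathcal X$ let $$W_p(\mu,\nu)=\Big(\min_{w\in\Pi(\mu,\nu)}\sum_{x,x'\in\mathcal X}d(x,x')^p\,w_{x,x'}\Big)^{1/p},$$ where $\Pi(\mu,\nu)$ is the set of probability measures on $\mathcal X\times\mathcal X$ with marginals $\mu$ and $\nu$. Let $S,B\ge 1$ be integers, and let $X_{ij}$, $Y_{ij}$ ($1\le i\le B$, $1\le j\le S$) be jointly independent $\mathcal X$-valued random variables with $X_{ij}\sim r$ and $Y_{ij}\sim s$. Put $\hat r_{S,i}(x)=\frac1S\#\{j: X_{ij}=x\}$, $\hat s_{S,i}(x)=\frac1S\#\{j: Y_{ij}=x\}$ and $$\hat W^{(S)}_p(r,s)=\frac1B\sum_{i=1}^B W_p(\hat r_{S,i},\hat s_{S,i}).$$ For integers $q\ge 2$ and $l_{\max}\ge 0$ let $$\mathcal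 E_q=2^{p-1}q^{2p}\,\mathrm{diam}(\mathcal X)^p\Big(q^{-(l_{\max}+1)p}\sqrt N+\sum_{l=0}^{l_{\max}}q^{-lp}\sqrt{\mathcal N(\mathcal X,q^{-l}\mathrm{diam}(\mathcal X))}\Big),$$ where $\mathcal N(\mathcal X,\delta)$ is the minimal number of closed balls of radius $\delta$ with centers in $\mathcal X$ needed to cover $\mathcal X$. Then for all integers $q\ge 2$ and $l_{\max}\ge 0$ and every real $z\ge 0$, $$P\Big[\,\big|\hat W^{(S)}_p(r,s)-W_p(r,s)\big|\ge z+2\,\mathcal E_q^{1/p}S^{-1/(2p)}\Big]\le 2\exp\Big(-\frac{SB\,z^{2p}}{8\,\mathrm{diam}(\mathcal X)^{2p}}\Big)$$ (if $N=1$, so that $\mathrm{diam}(\mathcal X)=0$, the quotient in the exponent is read as $0$ and the bound is trivial). -/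

import Mathlib

open MeasureTheory ProbabilityTheory

noncomputable section

namespace FiniteOT

/-- The couplings of two weight vectors `r`, `s`: probability vectors on `𝒳 × 𝒳` whose
marginals are `r` and `s`. -/
def couplings {𝒳 : Type*} [Fintype 𝒳] (r s : 𝒳 → ℝ) : Set (𝒳 × 𝒳 → ℝ) :=
  {w | w ∈ stdSimplex ℝ (𝒳 × 𝒳) ∧
    (∀ x, ∑ x', w (x, x') = r x) ∧ (∀ x', ∑ x, w (x, x') = s x')}

/-- The transport cost `∑ d(x, x')^p w(x, x')` of a coupling `w`. -/
def transportCost {𝒳 : Type*} [Fintype 𝒳] [MetricSpace 𝒳] (p : ℝ) (w : 𝒳 × 𝒳 → ℝ) : ℝ :=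
  ∑ x, ∑ x', dist x x' ^ p * w (x, x')

/-- The `p`-th Wasserstein distance of two probability vectors on a finite metric space.
The infimum is a minimum, see `isLeast_transportCost`. -/
def wasserstein {𝒳 : Type*} [Fintype 𝒳] [MetricSpace 𝒳] (p : ℝ) (r s : 𝒳 → ℝ) : ℝ :=
  (sInf (transportCost p '' couplings r s)) ^ (1 / p)

open Classical in
/-- The empirical measure of a sample `x 1, …, x S`: `a ↦ #{k | x k = a} / S`. -/
def empirical {𝒳 : Type*} {S : ℕ} (x : Fin S → 𝒳) : 𝒳 → ℝ :=
  fun a => ((Finset.univ.filter fun k => x k = a).card : ℝ) / S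

/-- The value returned by the subsampling algorithm with `B` repetitions, run on the samples
`x i 1, …, x i S` from the first measure and `y i 1, …, y i S` from the second one in the
`i`-th repetition: the average of the `B` empirical Wasserstein distances. -/
def subsampledWasserstein {𝒳 : Type*} [Fintype 𝒳] [MetricSpace 𝒳] (p : ℝ) {B S : ℕ}
    (x y : Fin B → Fin S → 𝒳) : ℝ :=
  (B : ℝ)⁻¹ * ∑ i, wasserstein p (empirical (x i)) (empirical (y i))

/-- The minimal number of closed balls of radius `δ` with centres in `𝒳` that cover `𝒳`
(finite, as `𝒳` is finite). -/
def coveringNum (𝒳 : Type*) [MetricSpace 𝒳] (δ : ℝ) : ℕ :=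
  (Metric.coveringNumber δ.toNNReal (Set.univ : Set 𝒳)).toNat

/-- The constant `ℰ_q(𝒳, p)`, for the parameters `q` and `lmax`. -/
def errorConst (𝒳 : Type*) [Fintype 𝒳] [MetricSpace 𝒳] (p : ℝ) (q lmax : ℕ) : ℝ :=
  2 ^ (p - 1) * (q : ℝ) ^ (2 * p) * Metric.diam (Set.univ : Set 𝒳) ^ p *
    ((q : ℝ) ^ (-(((lmax : ℝ) + 1) * p)) * √(Fintype.card 𝒳 : ℝ) +
      ∑ l ∈ Finset.range (lmax + 1), (q : ℝ) ^ (-((l : ℝ) * p)) *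
        √(coveringNum 𝒳 (((q : ℝ) ^ l)⁻¹ * Metric.diam (Set.univ : Set 𝒳)) : ℝ))

/-- The infimum that defines the Wasserstein distance is attained. -/
theorem isLeast_transportCost {𝒳 : Type*} [Fintype 𝒳] [MetricSpace 𝒳] (p : ℝ) {r s : 𝒳 → ℝ}
    (hr : r ∈ stdSimplex ℝ 𝒳) (hs : s ∈ stdSimplex ℝ 𝒳) :
    IsLeast (transportCost p '' couplings r s) (sInf (transportCost p '' couplings r s)) := by
  have hc : IsCompact (couplings r s) := by
    have h1 : IsClosed {w : 𝒳 × 𝒳 → ℝ | ∀ x, ∑ x', w (x, x') = r x} := by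
      rw [Set.ofPred_forall]
      exact isClosed_iInter fun x => isClosed_eq (by fun_prop) continuous_const
    have h2 : IsClosed {w : 𝒳 × 𝒳 → ℝ | ∀ x', ∑ x, w (x, x') = s x'} := by
      rw [Set.ofPred_forall]
      exact isClosed_iInter fun x => isClosed_eq (by fun_prop) continuous_const
    exact (isCompact_stdSimplex ℝ (𝒳 × 𝒳)).inter_right (h1.inter h2)
  have hne : (couplings r s).Nonempty := by
    refine ⟨fun z => r z.1 * s z.2, ⟨fun z => mul_nonneg (hr.1 _) (hs.1 _), ?_⟩, ?_, ?_⟩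
    · simp [Fintype.sum_prod_type, ← Finset.mul_sum, hr.2, hs.2]
    · intro x; simp [← Finset.mul_sum, hs.2]
    · intro x; simp [← Finset.sum_mul, hr.2]
  have hcont : Continuous (transportCost (𝒳 := 𝒳) p) := by
    unfold transportCost; fun_prop
  exact (hc.image hcont).isLeast_sInf (hne.image _)

end FiniteOT

end

/-!
The deviation `T = |Ŵ - W_p(r, s)|` is regarded as a function of the `2 S B` sample points, that is,
on a finite product space. Two facts are combined: its mean is at most `2 ℰ^(1/p) S^(-1/(2p))`, and
it exceeds its mean by `z` only with small probability.

*Mean.* By the triangle inequality `T` is at most the average of `W_p(r̂, r) + W_p(ŝ, s)`, and by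
Jensen's inequality it suffices to bound `E W_p(r̂, r)^p`. Minimal covers at the scales
`q⁻ˡ diam 𝒳` are organised into nested partitions (`exists_nested_partitions`). Matching mass
greedily, from the finest partition to the coarsest, gives one coupling of `r̂` and `r` that splits
as little mass as possible at all levels at once (`exists_coupling_levels`); a pair that is
split at one level but not at the next costs at most the diameter of a cell of the latter
(`wasserstein_rpow_le`). The mass split at a level is half the `ℓ¹` distance of the cell
frequencies, whose mean is at most `√(number of cells / S)` by a variance bound and the
Cauchy–Schwarz inequality. The level sum is the error constant
(`integral_wasserstein_rpow_le`).

*Concentration.* Changing `h` sample points changes `T` by at most `diam 𝒳 (h / (S B))^(1/p)`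
(`abs_subsampledJoint_sub_le`): gluing couplings, a quadruple in which either pair is split costs
at most one diameter, so both samples may be moved at once without the loss of a power of `2`.
Let `A = {T ≥ z + m}`, with `m` a bound for the mean, and let `f` be the Hamming distance
to `A`. Then `z ≤ diam 𝒳 (E f / (S B))^(1/p)`, while `f` vanishes on `A`, so that
McDiarmid's inequality bounds the probability of `A` by `exp(-(E f)² / (4 S B))`
(`sum_prodWeight_le_of_holder`). This gives the bound with `4` in place of `8` and
without the factor `2`.
-/

noncomputable section

namespace FiniteOT

/-! ### Concentration in Hamming distance on a finite product space -/

/-- The weight of the point `u` under the product of the weight vectors `v k`. -/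
def prodWeight {ι α : Type*} [Fintype ι] (v : ι → α → ℝ) (u : ι → α) : ℝ :=
  ∏ k, v k (u k)

open Classical in
/-- The number of coordinates in which `u` and `u'` differ, as a real number. -/
def ham {ι α : Type*} [Fintype ι] (u u' : ι → α) : ℝ :=
  ∑ k, if u k = u' k then 0 else 1

section

variable {ι α : Type*} [Fintype ι]

theorem ham_nonneg (u u' : ι → α) : 0 ≤ ham u u' :=
  Finset.sum_nonneg fun k _ => by split_ifs <;> norm_num

theorem ham_self (u : ι → α) : ham u u = 0 := by simp [ham]

theorem ham_comm (u u' : ι → α) : ham u u' = ham u' u := by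
  unfold ham
  exact Finset.sum_congr rfl fun k _ => by split_ifs <;> simp_all

theorem ham_triangle (u u' u'' : ι → α) : ham u u'' ≤ ham u u' + ham u' u'' := by
  unfold ham
  rw [← Finset.sum_add_distrib]
  refine Finset.sum_le_sum fun k _ => ?_
  by_cases h1 : u k = u' k
  · rw [h1]; simp
  · simp only [h1, if_false]
    split_ifs <;> norm_num

theorem prodWeight_nonneg {v : ι → α → ℝ} (hv : ∀ k x, 0 ≤ v k x) (u : ι → α) :
    0 ≤ prodWeight v u := Finset.prod_nonneg fun k _ => hv k _

open Classical in
theorem ham_cons {n : ℕ} (a b : α) (u u' : Fin n → α) :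
    ham (Fin.cons a u : Fin (n + 1) → α) (Fin.cons b u') = (if a = b then 0 else 1) + ham u u' := by
  unfold ham
  rw [Fin.sum_univ_succ]
  rfl

theorem prodWeight_cons {n : ℕ} (v : Fin (n + 1) → α → ℝ) (a : α) (u : Fin n → α) :
    prodWeight v (Fin.cons a u) = prodWeight (fun k => v k.succ) u * v 0 a := by
  simp [prodWeight, Fin.prod_univ_succ, mul_comm]

end

section

variable {α : Type*} [Fintype α]

theorem sum_prodWeight {ι : Type*} [Fintype ι] [DecidableEq ι] {v : ι → α → ℝ}
    (hv : ∀ k, v k ∈ stdSimplex ℝ α) :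
    ∑ u, prodWeight v u = 1 := by
  unfold prodWeight
  rw [← Fintype.prod_sum]
  simp [(hv _).2]

/-- A weak form of Hoeffding's lemma, proved by symmetrization: with an independent copy `g'` of
`g` one has `E exp(t g) ≤ E exp(t (g - g')) = E cosh(t (g - g'))`. -/
theorem sum_mul_exp_le {v g : α → ℝ} (hv : v ∈ stdSimplex ℝ α) (hg : ∑ x, v x * g x = 0)
    (hosc : ∀ x y, |g x - g y| ≤ 1) (t : ℝ) :
    ∑ x, v x * Real.exp (t * g x) ≤ Real.exp (t ^ 2 / 2) := by
  have h1 : 1 ≤ ∑ y, v y * Real.exp (-(t * g y)) := by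
    calc (1 : ℝ) = ∑ y, v y * (-(t * g y) + 1) := by
          simp only [mul_add, mul_one, Finset.sum_add_distrib, hv.2]
          have : ∑ y, v y * -(t * g y) = -t * ∑ y, v y * g y := by
            rw [Finset.mul_sum]; exact Finset.sum_congr rfl fun y _ => by ring
          rw [this, hg]; ring
      _ ≤ _ := Finset.sum_le_sum fun y _ =>
          mul_le_mul_of_nonneg_left (Real.add_one_le_exp _) (hv.1 y)
  have h2 : 0 ≤ ∑ x, v x * Real.exp (t * g x) :=
    Finset.sum_nonneg fun x _ => mul_nonneg (hv.1 x) (Real.exp_nonneg _)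
  set F := ∑ x, v x * Real.exp (t * g x)
  set G := ∑ y, v y * Real.exp (-(t * g y))
  have hFG : F * G = ∑ x, ∑ y, v x * v y * Real.exp (t * (g x - g y)) := by
    simp only [F, G, Finset.sum_mul_sum]
    refine Finset.sum_congr rfl fun x _ => Finset.sum_congr rfl fun y _ => ?_
    rw [mul_mul_mul_comm, ← Real.exp_add]; congr 2; ring
  have hGF : F * G = ∑ x, ∑ y, v x * v y * Real.exp (-(t * (g x - g y))) := by
    rw [hFG, Finset.sum_comm]
    refine Finset.sum_congr rfl fun x _ => Finset.sum_congr rfl fun y _ => ?_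
    rw [mul_comm (v y)]; congr 2; ring
  have hcosh : F * G = ∑ x, ∑ y, v x * v y * Real.cosh (t * (g x - g y)) := by
    have : F * G = (F * G + F * G) / 2 := by ring
    rw [this]
    nth_rewrite 2 [hGF]
    rw [hFG, ← Finset.sum_add_distrib, Finset.sum_div]
    refine Finset.sum_congr rfl fun x _ => ?_
    rw [← Finset.sum_add_distrib, Finset.sum_div]
    refine Finset.sum_congr rfl fun y _ => ?_
    rw [Real.cosh_eq]; ring
  calc F ≤ F * G := le_mul_of_one_le_right h2 h1
    _ = _ := hcosh
    _ ≤ ∑ x, ∑ y, v x * v y * Real.exp (t ^ 2 / 2) := by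
        refine Finset.sum_le_sum fun x _ => Finset.sum_le_sum fun y _ =>
          mul_le_mul_of_nonneg_left ?_ (mul_nonneg (hv.1 x) (hv.1 y))
        refine (Real.cosh_le_exp_half_sq _).trans (Real.exp_le_exp.2 ?_)
        have : (g x - g y) ^ 2 ≤ 1 := by
          rw [← sq_abs]; exact pow_le_one₀ (abs_nonneg _) (hosc x y)
        rw [mul_pow]
        nlinarith [sq_nonneg t]
    _ = Real.exp (t ^ 2 / 2) := by
        simp only [← Finset.sum_mul, ← Finset.mul_sum, hv.2]; ring

theorem sum_cons {n : ℕ} (F : (Fin (n + 1) → α) → ℝ) :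
    ∑ u, F u = ∑ u' : Fin n → α, ∑ a, F (Fin.cons a u') := by
  rw [← (Fin.consEquiv fun _ : Fin (n + 1) => α).sum_comp, Fintype.sum_prod_type,
    Finset.sum_comm]
  rfl

/-- The martingale bound for the exponential moment of a function that is `1`-Lipschitz for the
Hamming distance: the first coordinate is integrated out, which leaves such a function of the
others. -/
theorem sum_prodWeight_mul_exp_le_fin {n : ℕ} : ∀ {v : Fin n → α → ℝ}
    (_ : ∀ k, v k ∈ stdSimplex ℝ α) {f : (Fin n → α) → ℝ}
    (_ : ∀ u u', |f u - f u'| ≤ ham u u') (t : ℝ),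
    ∑ u, prodWeight v u * Real.exp (t * (f u - ∑ u', prodWeight v u' * f u')) ≤
      Real.exp (n * (t ^ 2 / 2)) := by
  induction n with
  | zero =>
    intro v hv f hf t
    simp [prodWeight]
  | succ n ih =>
    intro v hv f hf t
    set v' : Fin n → α → ℝ := fun k => v k.succ
    set g : (Fin n → α) → ℝ := fun u => ∑ a, v 0 a * f (Fin.cons a u)
    have hg : ∀ u u', |g u - g u'| ≤ ham u u' := by
      intro u u'
      simp only [g]
      rw [← Finset.sum_sub_distrib]
      calc _ ≤ ∑ a, |v 0 a * f (Fin.cons a u) - v 0 a * f (Fin.cons a u')| :=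
            Finset.abs_sum_le_sum_abs _ _
        _ ≤ ∑ a, v 0 a * ham u u' := by
            refine Finset.sum_le_sum fun a _ => ?_
            rw [← mul_sub, abs_mul, abs_of_nonneg ((hv 0).1 a)]
            refine mul_le_mul_of_nonneg_left ((hf _ _).trans_eq ?_) ((hv 0).1 a)
            rw [ham_cons, if_pos rfl, zero_add]
        _ = ham u u' := by rw [← Finset.sum_mul, (hv 0).2, one_mul]
    have hmean : ∑ u, prodWeight v u * f u = ∑ u, prodWeight v' u * g u := by
      rw [sum_cons]
      refine Finset.sum_congr rfl fun u _ => ?_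
      simp only [g, Finset.mul_sum, prodWeight_cons, v', mul_assoc]
    rw [hmean, sum_cons]
    set m := ∑ u, prodWeight v' u * g u
    have hv' : ∀ k, v' k ∈ stdSimplex ℝ α := fun k => hv k.succ
    calc _ = ∑ u, prodWeight v' u * Real.exp (t * (g u - m)) *
            ∑ a, v 0 a * Real.exp (t * (f (Fin.cons a u) - g u)) := by
          refine Finset.sum_congr rfl fun u _ => ?_
          rw [Finset.mul_sum]
          refine Finset.sum_congr rfl fun a _ => ?_
          rw [prodWeight_cons, mul_mul_mul_comm, ← Real.exp_add]
          congr 2; ring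
      _ ≤ ∑ u, prodWeight v' u * Real.exp (t * (g u - m)) * Real.exp (t ^ 2 / 2) := by
          refine Finset.sum_le_sum fun u _ => mul_le_mul_of_nonneg_left ?_
            (mul_nonneg (prodWeight_nonneg (fun k => (hv' k).1) u) (Real.exp_nonneg _))
          refine sum_mul_exp_le (hv 0) ?_ ?_ t
          · simp only [mul_sub, Finset.sum_sub_distrib, ← Finset.sum_mul, (hv 0).2, g, one_mul,
              sub_self]
          · intro a b
            rw [sub_sub_sub_cancel_right]
            refine (hf _ _).trans ?_
            rw [ham_cons, ham_self]
            split_ifs <;> simp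
      _ ≤ Real.exp (n * (t ^ 2 / 2)) * Real.exp (t ^ 2 / 2) := by
          rw [← Finset.sum_mul]
          exact mul_le_mul_of_nonneg_right (ih hv' hg t) (Real.exp_nonneg _)
      _ = _ := by rw [← Real.exp_add]; push_cast; congr 1; ring

variable {ι : Type*} [Fintype ι] [DecidableEq ι]

/-- `sum_prodWeight_mul_exp_le_fin` for an arbitrary finite index type. -/
theorem sum_prodWeight_mul_exp_le {v : ι → α → ℝ}
    (hv : ∀ k, v k ∈ stdSimplex ℝ α) {f : (ι → α) → ℝ}
    (hf : ∀ u u', |f u - f u'| ≤ ham u u') (t : ℝ) :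
    ∑ u, prodWeight v u * Real.exp (t * (f u - ∑ u', prodWeight v u' * f u')) ≤
      Real.exp (Fintype.card ι * (t ^ 2 / 2)) := by
  let e := Fintype.equivFin ι
  let E : (Fin (Fintype.card ι) → α) ≃ (ι → α) := Equiv.arrowCongr e.symm (Equiv.refl α)
  have hE : ∀ u k, E u k = u (e k) := fun u k => rfl
  have hw : ∀ u, prodWeight v (E u) = prodWeight (fun k => v (e.symm k)) u := by
    intro u
    simp only [prodWeight, hE]
    rw [← e.prod_comp]; simp
  have h := sum_prodWeight_mul_exp_le_fin (v := fun k => v (e.symm k)) (fun k => hv _)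
    (f := fun u => f (E u)) (fun u u' => (hf _ _).trans_eq ?_) t
  · rw [← E.sum_comp, ← E.sum_comp (fun u' => prodWeight v u' * f u')]
    simpa only [hw] using h
  · simp only [ham, hE]
    classical
    exact e.sum_comp fun k => if u k = u' k then (0 : ℝ) else 1

/-- McDiarmid's inequality for the lower tail (with a fourth of the optimal constant in the exponent,
which suffices here), in the form of a bound for the probability that a
Lipschitz function vanishes. -/
theorem sum_prodWeight_le_exp [Nonempty ι] {v : ι → α → ℝ}
    (hv : ∀ k, v k ∈ stdSimplex ℝ α) {f : (ι → α) → ℝ}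
    (hf : ∀ u u', |f u - f u'| ≤ ham u u') {A : Finset (ι → α)} (hA : ∀ u ∈ A, f u = 0) :
    ∑ u ∈ A, prodWeight v u ≤
      Real.exp (-(∑ u, prodWeight v u * f u) ^ 2 / (2 * Fintype.card ι)) := by
  set m := ∑ u, prodWeight v u * f u with hm
  set n := ((Fintype.card ι : ℕ) : ℝ) with hn
  have hn0 : 0 < n := by rw [hn]; exact_mod_cast Fintype.card_pos
  -- Chernoff's bound with the optimal parameter
  set t := -(m / n) with ht
  have h := sum_prodWeight_mul_exp_le hv hf t
  have hw := prodWeight_nonneg fun k => (hv k).1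
  have h2 : (∑ u ∈ A, prodWeight v u) * Real.exp (m ^ 2 / n) ≤ Real.exp (n * (t ^ 2 / 2)) := by
    refine le_trans ?_ h
    rw [Finset.sum_mul]
    refine le_trans (Finset.sum_le_sum fun u hu => ?_) (Finset.sum_le_sum_of_subset_of_nonneg
      (Finset.subset_univ A) fun u _ _ => mul_nonneg (hw u) (Real.exp_nonneg _))
    rw [hA u hu, ht]
    refine le_of_eq ?_
    congr 2; rw [← hm]; ring
  rw [← le_div_iff₀ (Real.exp_pos _), ← Real.exp_sub] at h2
  refine h2.trans_eq ?_
  congr 1; rw [ht]; field_simp; ring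

/-- There is a function `f`, the Hamming distance to `A`, whose mean controls the probability
of `A`. -/
theorem exists_distance_to [Nonempty ι] {v : ι → α → ℝ}
    (hv : ∀ k, v k ∈ stdSimplex ℝ α) {A : Finset (ι → α)} (hA : A.Nonempty) :
    ∃ f : (ι → α) → ℝ, (∀ u, 0 ≤ f u) ∧ (∀ u, ∃ a ∈ A, f u = ham u a) ∧
      ∑ u ∈ A, prodWeight v u ≤
        Real.exp (-(∑ u, prodWeight v u * f u) ^ 2 / (2 * Fintype.card ι)) := by
  have hex : ∀ u, ∃ a ∈ A, A.inf' hA (ham u) = ham u a := fun u =>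
    Finset.exists_mem_eq_inf' hA _
  have hle : ∀ u u', A.inf' hA (ham u) ≤ A.inf' hA (ham u') + ham u u' := by
    intro u u'
    obtain ⟨a, ha, hau⟩ := hex u'
    rw [hau]
    have := ham_triangle u u' a
    linarith [Finset.inf'_le (ham u) ha]
  refine ⟨fun u => A.inf' hA (ham u), fun u => ?_, hex, sum_prodWeight_le_exp hv ?_ ?_⟩
  · obtain ⟨a, _, h⟩ := hex u
    exact (ham_nonneg _ _).trans_eq h.symm
  · intro u u'
    rw [abs_sub_le_iff]
    constructor
    · linarith [hle u u']
    · linarith [hle u' u, ham_comm u u']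
  · intro u hu
    refine le_antisymm ((Finset.inf'_le _ hu).trans_eq (ham_self u)) ?_
    obtain ⟨a, _, h⟩ := hex u
    rw [h]; exact ham_nonneg _ _

end

/-! ### Gluing of couplings and the triangle inequality -/

section

variable {𝒳 : Type*} [Fintype 𝒳]

theorem le_fst_of_mem_couplings {μ ν : 𝒳 → ℝ} {w : 𝒳 × 𝒳 → ℝ} (hw : w ∈ couplings μ ν)
    (a b : 𝒳) : w (a, b) ≤ μ a := by
  rw [← hw.2.1 a]
  exact Finset.single_le_sum (f := fun b => w (a, b)) (fun b _ => hw.1.1 _) (Finset.mem_univ b)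

theorem le_snd_of_mem_couplings {μ ν : 𝒳 → ℝ} {w : 𝒳 × 𝒳 → ℝ} (hw : w ∈ couplings μ ν)
    (a b : 𝒳) : w (a, b) ≤ ν b := by
  rw [← hw.2.2 b]
  exact Finset.single_le_sum (f := fun a => w (a, b)) (fun a _ => hw.1.1 _) (Finset.mem_univ a)

theorem sum_fst_eq [DecidableEq 𝒳] (w : 𝒳 × 𝒳 → ℝ) (a : 𝒳) :
    ∑ b, w (a, b) = ∑ z, w z * (if z.1 = a then 1 else 0) := by
  rw [Fintype.sum_prod_type, Finset.sum_comm]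
  simp

theorem sum_snd_eq [DecidableEq 𝒳] (w : 𝒳 × 𝒳 → ℝ) (b : 𝒳) :
    ∑ a, w (a, b) = ∑ z, w z * (if z.2 = b then 1 else 0) := by
  rw [Fintype.sum_prod_type]
  simp

theorem mem_couplings_swap {μ ν : 𝒳 → ℝ} {w : 𝒳 × 𝒳 → ℝ} (hw : w ∈ couplings μ ν) :
    (fun z => w z.swap) ∈ couplings ν μ := by
  refine ⟨⟨fun z => hw.1.1 _, ?_⟩, hw.2.2, hw.2.1⟩
  rw [← hw.1.2]
  exact (Equiv.prodComm 𝒳 𝒳).sum_comp w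

/-- Three couplings of `(μ', μ)`, `(μ, ν)` and `(ν, ν')` are the marginals of one weight vector `θ`
on quadruples `((a, b), (c, e))`; the marginals are expressed by integrals of test functions. -/
theorem exists_glue {μ μ' ν ν' : 𝒳 → ℝ} {α w β : 𝒳 × 𝒳 → ℝ} (hα : α ∈ couplings μ' μ)
    (hw : w ∈ couplings μ ν) (hβ : β ∈ couplings ν ν') :
    ∃ θ : (𝒳 × 𝒳) × (𝒳 × 𝒳) → ℝ, (∀ y, 0 ≤ θ y) ∧
      (∀ F : 𝒳 × 𝒳 → ℝ, ∑ y, θ y * F y.1 = ∑ z, α z * F z) ∧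
      (∀ F : 𝒳 × 𝒳 → ℝ, ∑ y, θ y * F (y.1.2, y.2.1) = ∑ z, w z * F z) ∧
      (∀ F : 𝒳 × 𝒳 → ℝ, ∑ y, θ y * F y.2 = ∑ z, β z * F z) := by
  have hμ : ∀ b, 0 ≤ μ b := fun b => by
    rw [← hw.2.1 b]; exact Finset.sum_nonneg fun c _ => hw.1.1 _
  have hν : ∀ c, 0 ≤ ν c := fun c => by
    rw [← hw.2.2 c]; exact Finset.sum_nonneg fun b _ => hw.1.1 _
  have hdiv2 : ∀ b c, w (b, c) / (μ b * ν c) * ν c = w (b, c) / μ b := by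
    intro b c
    rcases eq_or_ne (ν c) 0 with h | h
    · have : w (b, c) = 0 := le_antisymm (h ▸ le_snd_of_mem_couplings hw b c) (hw.1.1 _)
      simp [this]
    · field_simp
  have hdiv1 : ∀ b c, μ b * (w (b, c) / (μ b * ν c)) = w (b, c) / ν c := by
    intro b c
    rcases eq_or_ne (μ b) 0 with h | h
    · have : w (b, c) = 0 := le_antisymm (h ▸ le_fst_of_mem_couplings hw b c) (hw.1.1 _)
      simp [this]
    · field_simp
  refine ⟨fun y => α y.1 * (w (y.1.2, y.2.1) / (μ y.1.2 * ν y.2.1)) * β y.2, ?_, ?_, ?_, ?_⟩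
  · exact fun y => mul_nonneg (mul_nonneg (hα.1.1 _) (div_nonneg (hw.1.1 _)
      (mul_nonneg (hμ _) (hν _)))) (hβ.1.1 _)
  · intro F
    rw [Fintype.sum_prod_type]
    refine Finset.sum_congr rfl fun z _ => ?_
    obtain ⟨a, b⟩ := z
    rw [Fintype.sum_prod_type]
    have : ∀ c, ∑ e, α (a, b) * (w (b, c) / (μ b * ν c)) * β (c, e) * F (a, b)
        = α (a, b) * F (a, b) / μ b * w (b, c) := by
      intro c
      rw [← Finset.sum_mul, ← Finset.mul_sum, hβ.2.1 c, mul_assoc (α (a, b)), hdiv2]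
      ring
    simp only [this]
    rw [← Finset.mul_sum, hw.2.1 b]
    rcases eq_or_ne (μ b) 0 with h | h
    · have : α (a, b) = 0 := le_antisymm (h ▸ le_snd_of_mem_couplings hα a b) (hα.1.1 _)
      simp [this]
    · field_simp
  · intro F
    rw [Fintype.sum_prod_type, Fintype.sum_prod_type, Finset.sum_comm, Fintype.sum_prod_type]
    refine Finset.sum_congr rfl fun b _ => ?_
    simp only [Fintype.sum_prod_type]
    rw [Finset.sum_comm]
    refine Finset.sum_congr rfl fun c _ => ?_
    have : ∀ a, ∑ e, α (a, b) * (w (b, c) / (μ b * ν c)) * β (c, e) * F (b, c)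
        = α (a, b) * (w (b, c) / (μ b * ν c) * ν c * F (b, c)) := by
      intro a
      rw [← Finset.sum_mul, ← Finset.mul_sum, hβ.2.1 c]
      ring
    simp only [this]
    rw [← Finset.sum_mul, hα.2.2 b, hdiv2]
    rcases eq_or_ne (μ b) 0 with h | h
    · have : w (b, c) = 0 := le_antisymm (h ▸ le_fst_of_mem_couplings hw b c) (hw.1.1 _)
      simp [this]
    · field_simp
  · intro F
    rw [Fintype.sum_prod_type, Finset.sum_comm]
    refine Finset.sum_congr rfl fun z _ => ?_
    obtain ⟨c, e⟩ := z
    rw [Fintype.sum_prod_type, Finset.sum_comm]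
    have : ∀ b, ∑ a, α (a, b) * (w (b, c) / (μ b * ν c)) * β (c, e) * F (c, e)
        = β (c, e) * F (c, e) / ν c * w (b, c) := by
      intro b
      rw [← Finset.sum_mul, ← Finset.sum_mul, ← Finset.sum_mul, hα.2.2 b, hdiv1]
      ring
    simp only [this]
    rw [← Finset.mul_sum, hw.2.2 c]
    rcases eq_or_ne (ν c) 0 with h | h
    · have : β (c, e) = 0 := le_antisymm (h ▸ le_fst_of_mem_couplings hβ c e) (hβ.1.1 _)
      simp [this]
    · field_simp

/-- Minkowski's inequality with weights. -/
theorem sum_mul_add_rpow_le {Y : Type*} [Fintype Y] {p : ℝ} (hp : 1 ≤ p) {θ f g : Y → ℝ}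
    (hθ : ∀ y, 0 ≤ θ y) (hf : ∀ y, 0 ≤ f y) (hg : ∀ y, 0 ≤ g y) :
    (∑ y, θ y * (f y + g y) ^ p) ^ (1 / p) ≤
      (∑ y, θ y * f y ^ p) ^ (1 / p) + (∑ y, θ y * g y ^ p) ^ (1 / p) := by
  have hp0 : p ≠ 0 := by positivity
  have key : ∀ (h : Y → ℝ), (∀ y, 0 ≤ h y) → ∀ y, (θ y ^ (1 / p) * h y) ^ p = θ y * h y ^ p := by
    intro h hh y
    rw [Real.mul_rpow (Real.rpow_nonneg (hθ y) _) (hh y), ← Real.rpow_mul (hθ y),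
      one_div_mul_cancel hp0, Real.rpow_one]
  have := Real.Lp_add_le_of_nonneg (s := Finset.univ) (f := fun y => θ y ^ (1 / p) * f y)
    (g := fun y => θ y ^ (1 / p) * g y) hp
    (fun y _ => mul_nonneg (Real.rpow_nonneg (hθ y) _) (hf y))
    (fun y _ => mul_nonneg (Real.rpow_nonneg (hθ y) _) (hg y))
  simp only [key f hf, key g hg, ← mul_add] at this
  simpa only [key (fun y => f y + g y) fun y => add_nonneg (hf y) (hg y)] using this

end

section

variable {𝒳 : Type*} [Fintype 𝒳] [MetricSpace 𝒳] {p : ℝ}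

theorem dist_le_diam_univ (x y : 𝒳) : dist x y ≤ Metric.diam (Set.univ : Set 𝒳) :=
  Metric.dist_le_diam_of_mem Set.finite_univ.isBounded (Set.mem_univ x) (Set.mem_univ y)

theorem transportCost_eq_sum (w : 𝒳 × 𝒳 → ℝ) :
    transportCost p w = ∑ z, w z * dist z.1 z.2 ^ p := by
  rw [Fintype.sum_prod_type]
  exact Finset.sum_congr rfl fun x _ => Finset.sum_congr rfl fun y _ => mul_comm _ _

theorem transportCost_nonneg {w : 𝒳 × 𝒳 → ℝ} (hw : ∀ z, 0 ≤ w z) : 0 ≤ transportCost p w := by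
  rw [transportCost_eq_sum]
  exact Finset.sum_nonneg fun z _ => mul_nonneg (hw z) (Real.rpow_nonneg dist_nonneg _)

theorem exists_optimal_coupling {μ ν : 𝒳 → ℝ} (hμ : μ ∈ stdSimplex ℝ 𝒳)
    (hν : ν ∈ stdSimplex ℝ 𝒳) :
    ∃ w ∈ couplings μ ν, wasserstein p μ ν = transportCost p w ^ (1 / p) := by
  obtain ⟨w, hw, h⟩ := (isLeast_transportCost p hμ hν).1
  exact ⟨w, hw, by rw [wasserstein, ← h]⟩

theorem wasserstein_le_transportCost (hp : 1 ≤ p) {μ ν : 𝒳 → ℝ} {w : 𝒳 × 𝒳 → ℝ}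
    (hw : w ∈ couplings μ ν) : wasserstein p μ ν ≤ transportCost p w ^ (1 / p) := by
  have hbdd : ∀ c ∈ transportCost p '' couplings μ ν, 0 ≤ c := by
    rintro _ ⟨w, hw, rfl⟩
    exact transportCost_nonneg hw.1.1
  exact Real.rpow_le_rpow (Real.sInf_nonneg hbdd) (csInf_le ⟨0, hbdd⟩ ⟨w, hw, rfl⟩)
    (by positivity)

theorem wasserstein_nonneg (μ ν : 𝒳 → ℝ) : 0 ≤ wasserstein p μ ν := by
  refine Real.rpow_nonneg (Real.sInf_nonneg ?_) _
  rintro _ ⟨w, hw, rfl⟩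
  exact transportCost_nonneg hw.1.1

theorem wasserstein_comm (μ ν : 𝒳 → ℝ) : wasserstein p μ ν = wasserstein p ν μ := by
  have key : ∀ μ ν : 𝒳 → ℝ,
      transportCost p '' couplings μ ν ⊆ transportCost p '' couplings ν μ := by
    rintro μ ν _ ⟨w, hw, rfl⟩
    refine ⟨_, mem_couplings_swap hw, ?_⟩
    unfold transportCost
    rw [Finset.sum_comm]
    simp only [Prod.swap, dist_comm]
  rw [wasserstein, wasserstein, (key μ ν).antisymm (key ν μ)]

/-- If `θ` glues couplings of `(μ', μ)` and `(ν, ν')`, then any bound `g` for the distance of the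
outer points of a quadruple bounds the Wasserstein distance of `μ'` and `ν'`. -/
theorem wasserstein_le_of_glue (hp : 1 ≤ p) {μ μ' ν ν' : 𝒳 → ℝ} {α β : 𝒳 × 𝒳 → ℝ}
    (hα : α ∈ couplings μ' μ) (hβ : β ∈ couplings ν ν') {θ g : (𝒳 × 𝒳) × (𝒳 × 𝒳) → ℝ}
    (hθ : ∀ y, 0 ≤ θ y) (h1 : ∀ F : 𝒳 × 𝒳 → ℝ, ∑ y, θ y * F y.1 = ∑ z, α z * F z)
    (h3 : ∀ F : 𝒳 × 𝒳 → ℝ, ∑ y, θ y * F y.2 = ∑ z, β z * F z)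
    (hg : ∀ y, dist y.1.1 y.2.2 ≤ g y) :
    wasserstein p μ' ν' ≤ (∑ y, θ y * g y ^ p) ^ (1 / p) := by
  classical
  let τ : 𝒳 × 𝒳 → ℝ := fun z => ∑ y, if (y.1.1, y.2.2) = z then θ y else 0
  have hsum : ∀ F : 𝒳 × 𝒳 → ℝ, ∑ z, τ z * F z = ∑ y, θ y * F (y.1.1, y.2.2) := by
    intro F
    simp only [τ, Finset.sum_mul]
    rw [Finset.sum_comm]
    refine Finset.sum_congr rfl fun y _ => ?_
    simp only [ite_mul, zero_mul, Finset.sum_ite_eq, Finset.mem_univ, if_true]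
  have hτ : τ ∈ couplings μ' ν' := by
    refine ⟨⟨fun z => Finset.sum_nonneg fun y _ => by split_ifs <;> simp [hθ y], ?_⟩, ?_, ?_⟩
    · have e1 := hsum fun _ => 1
      have e2 := h1 fun _ => 1
      simp only [mul_one] at e1 e2
      rw [e1, e2, hα.1.2]
    · intro a
      rw [sum_fst_eq, hsum, ← hα.2.1 a, sum_fst_eq, ← h1]
    · intro a
      rw [sum_snd_eq, hsum, ← hβ.2.2 a, sum_snd_eq, ← h3]
  refine (wasserstein_le_transportCost hp hτ).trans ?_
  rw [transportCost_eq_sum, hsum]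
  refine Real.rpow_le_rpow (Finset.sum_nonneg fun y _ => mul_nonneg (hθ y)
    (Real.rpow_nonneg dist_nonneg _)) (Finset.sum_le_sum fun y _ => ?_) (by positivity)
  exact mul_le_mul_of_nonneg_left (Real.rpow_le_rpow dist_nonneg (hg y) (by positivity)) (hθ y)

theorem wasserstein_triangle (hp : 1 ≤ p) {μ μ' ν ν' : 𝒳 → ℝ} (hμ : μ ∈ stdSimplex ℝ 𝒳)
    (hμ' : μ' ∈ stdSimplex ℝ 𝒳) (hν : ν ∈ stdSimplex ℝ 𝒳) (hν' : ν' ∈ stdSimplex ℝ 𝒳) :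
    wasserstein p μ' ν' ≤ wasserstein p μ' μ + wasserstein p μ ν + wasserstein p ν ν' := by
  obtain ⟨α, hα, hα'⟩ := exists_optimal_coupling (p := p) hμ' hμ
  obtain ⟨w, hw, hw'⟩ := exists_optimal_coupling (p := p) hμ hν
  obtain ⟨β, hβ, hβ'⟩ := exists_optimal_coupling (p := p) hν hν'
  obtain ⟨θ, hθ, h1, h2, h3⟩ := exists_glue hα hw hβ
  rw [hα', hw', hβ', transportCost_eq_sum, transportCost_eq_sum, transportCost_eq_sum, ← h1, ← h2,
    ← h3]
  refine (wasserstein_le_of_glue hp hα hβ hθ h1 h3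
    (g := fun y => dist y.1.1 y.1.2 + dist y.1.2 y.2.1 + dist y.2.1 y.2.2)
    fun y => dist_triangle4 _ _ _ _).trans ?_
  refine (sum_mul_add_rpow_le hp hθ (fun y => by positivity) fun y => dist_nonneg).trans ?_
  gcongr
  exact sum_mul_add_rpow_le hp hθ (fun y => dist_nonneg) fun y => dist_nonneg

open Classical in
/-- Stability of the Wasserstein distance in the mass that is moved by couplings `α`, `β`. Moving
in the two arguments at the same time costs only the `p`-th root of the total mass, since a
quadruple in which some pair is split contributes at most one diameter. -/
theorem wasserstein_le_add_diam_mul (hp : 1 ≤ p) {μ μ' ν ν' : 𝒳 → ℝ} {α β : 𝒳 × 𝒳 → ℝ}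
    (hμ : μ ∈ stdSimplex ℝ 𝒳) (hν : ν ∈ stdSimplex ℝ 𝒳)
    (hα : α ∈ couplings μ' μ) (hβ : β ∈ couplings ν ν') :
    wasserstein p μ' ν' ≤ wasserstein p μ ν + Metric.diam (Set.univ : Set 𝒳) *
      ((∑ z, α z * if z.1 = z.2 then 0 else 1) + ∑ z, β z * if z.1 = z.2 then 0 else 1) ^
        (1 / p) := by
  obtain ⟨w, hw, hw'⟩ := exists_optimal_coupling (p := p) hμ hν
  obtain ⟨θ, hθ, h1, h2, h3⟩ := exists_glue hα hw hβ
  rw [hw', transportCost_eq_sum, ← h1, ← h2, ← h3]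
  set D := Metric.diam (Set.univ : Set 𝒳)
  have hD : 0 ≤ D := Metric.diam_nonneg
  have hp0 : 0 < p := by positivity
  refine (wasserstein_le_of_glue hp hα hβ hθ h1 h3
    (g := fun y => dist y.1.2 y.2.1 + if y.1.1 = y.1.2 ∧ y.2.1 = y.2.2 then 0 else D)
    fun y => ?_).trans ?_
  · split_ifs with h
    · rw [h.1, ← h.2, add_zero]
    · exact (dist_le_diam_univ _ _).trans (le_add_of_nonneg_left dist_nonneg)
  refine (sum_mul_add_rpow_le hp hθ (fun y => dist_nonneg) fun y => ?_).trans ?_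
  · split_ifs <;> simp [hD]
  refine add_le_add le_rfl ?_
  have hDp : D = (D ^ p) ^ (1 / p) := by
    rw [← Real.rpow_mul hD, mul_one_div_cancel hp0.ne', Real.rpow_one]
  nth_rewrite 2 [hDp]
  have hnn : ∀ y : (𝒳 × 𝒳) × (𝒳 × 𝒳), (0 : ℝ) ≤ (if y.1.1 = y.1.2 then 0 else 1) +
      if y.2.1 = y.2.2 then 0 else 1 := fun y => by split_ifs <;> norm_num
  rw [← Finset.sum_add_distrib, ← Real.mul_rpow (by positivity)
    (Finset.sum_nonneg fun y _ => by rw [← mul_add]; exact mul_nonneg (hθ y) (hnn y)),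
    Finset.mul_sum]
  refine Real.rpow_le_rpow (Finset.sum_nonneg fun y _ => mul_nonneg (hθ y) (Real.rpow_nonneg
    (by split_ifs <;> simp [hD]) _)) (Finset.sum_le_sum fun y _ => ?_) (by positivity)
  rw [← mul_add, mul_left_comm]
  refine mul_le_mul_of_nonneg_left ?_ (hθ y)
  have hDp0 : 0 ≤ D ^ p := Real.rpow_nonneg hD _
  by_cases h : y.1.1 = y.1.2 <;> by_cases h' : y.2.1 = y.2.2 <;>
    (simp [h, h', Real.zero_rpow hp0.ne']; try linarith)

end

/-! ### Empirical measures -/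

section

variable {𝒳 : Type*} [Fintype 𝒳] {S : ℕ}

theorem sum_empirical_mul (x : Fin S → 𝒳) (F : 𝒳 → ℝ) :
    ∑ a, empirical x a * F a = (S : ℝ)⁻¹ * ∑ k, F (x k) := by
  classical
  have : ∀ a, empirical x a * F a = (S : ℝ)⁻¹ * ∑ k, if x k = a then F a else 0 := by
    intro a
    rw [empirical, ← Finset.sum_filter, Finset.sum_const, nsmul_eq_mul]
    have : (Finset.univ.filter fun k => x k = a).card =
      (@Finset.filter (Fin S) (fun k => x k = a) (fun _ => Classical.propDecidable _)
        Finset.univ).card := by congr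
    rw [this]; ring
  simp only [this, ← Finset.mul_sum]
  rw [Finset.sum_comm]
  simp

theorem empirical_mem_stdSimplex (hS : 1 ≤ S) (x : Fin S → 𝒳) :
    empirical x ∈ stdSimplex ℝ 𝒳 := by
  refine ⟨fun a => div_nonneg (Nat.cast_nonneg _) (Nat.cast_nonneg _), ?_⟩
  have := sum_empirical_mul x fun _ => 1
  have hS0 : (S : ℝ) ≠ 0 := by positivity
  simpa [hS0] using this

/-- The empirical measure of a sample of pairs couples those of its components. -/
theorem empirical_prod_mem_couplings (hS : 1 ≤ S) (x x' : Fin S → 𝒳) :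
    empirical (fun k => (x k, x' k)) ∈ couplings (empirical x) (empirical x') := by
  classical
  have hemp : ∀ (x : Fin S → 𝒳) a, empirical x a = (S : ℝ)⁻¹ * ∑ k, if x k = a then 1 else 0 := by
    intro x a
    rw [← sum_empirical_mul x fun b => if b = a then 1 else 0]
    simp
  refine ⟨empirical_mem_stdSimplex hS _, fun a => ?_, fun a => ?_⟩
  · rw [sum_fst_eq, sum_empirical_mul, hemp]
  · rw [sum_snd_eq, sum_empirical_mul, hemp]

variable [MetricSpace 𝒳] {p : ℝ}

theorem abs_wasserstein_empirical_sub_le (hp : 1 ≤ p) (hS : 1 ≤ S) (x x' y y' : Fin S → 𝒳) :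
    |wasserstein p (empirical x) (empirical y) - wasserstein p (empirical x') (empirical y')| ≤
      Metric.diam (Set.univ : Set 𝒳) * ((ham x x' + ham y y') / S) ^ (1 / p) := by
  have key : ∀ x x' y y' : Fin S → 𝒳, wasserstein p (empirical x) (empirical y) -
      wasserstein p (empirical x') (empirical y') ≤
      Metric.diam (Set.univ : Set 𝒳) * ((ham x x' + ham y y') / S) ^ (1 / p) := by
    intro x x' y y'
    have h := wasserstein_le_add_diam_mul hp (empirical_mem_stdSimplex hS x')
      (empirical_mem_stdSimplex hS y') (empirical_prod_mem_couplings hS x x')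
      (empirical_prod_mem_couplings hS y' y)
    rw [sum_empirical_mul, sum_empirical_mul, ← mul_add] at h
    rw [sub_le_iff_le_add', div_eq_inv_mul, ham_comm y y']
    exact h
  rw [abs_sub_le_iff]
  refine ⟨key x x' y y', ?_⟩
  rw [ham_comm x, ham_comm y]
  exact key x' x y' y

end

/-! ### Greedy coupling along nested partitions -/

open Classical in
/-- The mass that `μ` gives to the cell `{x | π x = c}`. -/
def cellMass {α : Type*} [Fintype α] (π : α → α) (μ : α → ℝ) (c : α) : ℝ :=
  ∑ x, if π x = c then μ x else 0

/-- The mass of a pair of weight vectors that can be matched within the cells of `π`. -/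
def overlap {α : Type*} [Fintype α] (π : α → α) (μ ν : α → ℝ) : ℝ :=
  ∑ c, min (cellMass π μ c) (cellMass π ν c)

section

variable {α : Type*} [Fintype α]

theorem cellMass_nonneg (π : α → α) {μ : α → ℝ} (hμ : ∀ x, 0 ≤ μ x) (c : α) :
    0 ≤ cellMass π μ c :=
  Finset.sum_nonneg fun x _ => by split_ifs <;> simp [hμ x]

theorem sum_cellMass (π : α → α) (μ : α → ℝ) : ∑ c, cellMass π μ c = ∑ x, μ x := by
  classical
  unfold cellMass
  rw [Finset.sum_comm]
  simp

theorem cellMass_mul (π : α → α) (f : α → ℝ) (g : α → ℝ) (c : α) :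
    cellMass π (fun x => f x * g (π x)) c = cellMass π f c * g c := by
  unfold cellMass
  rw [Finset.sum_mul]
  refine Finset.sum_congr rfl fun x _ => ?_
  by_cases h : π x = c <;> simp [h]

theorem cellMass_add (π : α → α) (f g : α → ℝ) (c : α) :
    cellMass π (fun x => f x + g x) c = cellMass π f c + cellMass π g c := by
  unfold cellMass
  rw [← Finset.sum_add_distrib]
  exact Finset.sum_congr rfl fun x _ => by split_ifs <;> simp

theorem one_sub_overlap (π : α → α) {μ ν : α → ℝ} (hμ : ∑ x, μ x = 1) (hν : ∑ x, ν x = 1) :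
    1 - overlap π μ ν = 1 / 2 * ∑ c, |cellMass π μ c - cellMass π ν c| := by
  have : overlap π μ ν = ∑ c, (cellMass π μ c / 2 + cellMass π ν c / 2 -
      1 / 2 * |cellMass π μ c - cellMass π ν c|) := by
    refine Finset.sum_congr rfl fun c _ => ?_
    rcases le_total (cellMass π μ c) (cellMass π ν c) with h | h
    · rw [min_eq_left h, abs_of_nonpos (sub_nonpos.2 h)]; ring
    · rw [min_eq_right h, abs_of_nonneg (sub_nonneg.2 h)]; ring
  rw [this, Finset.sum_sub_distrib, Finset.sum_add_distrib, ← Finset.sum_div, ← Finset.sum_div,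
    sum_cellMass, sum_cellMass, hμ, hν, ← Finset.mul_sum]
  ring

/-- One step of the greedy matching: a partial coupling supported on the pairs inside the cells of
`π` is enlarged until in each cell the mass of `μ` or that of `ν` is used up. -/
theorem exists_exhausting_partial_coupling (π : α → α) {μ ν : α → ℝ} {w : α × α → ℝ}
    (h1 : ∀ a, ∑ b, w (a, b) ≤ μ a) (h2 : ∀ b, ∑ a, w (a, b) ≤ ν b)
    (hsupp : ∀ a b, π a ≠ π b → w (a, b) = 0) :
    ∃ w' : α × α → ℝ, (∀ z, w z ≤ w' z) ∧ (∀ a, ∑ b, w' (a, b) ≤ μ a) ∧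
      (∀ b, ∑ a, w' (a, b) ≤ ν b) ∧ (∀ a b, π a ≠ π b → w' (a, b) = 0) ∧
      overlap π μ ν ≤ ∑ z, w' z := by
  classical
  set u : α → ℝ := fun a => μ a - ∑ b, w (a, b) with hu
  set v : α → ℝ := fun b => ν b - ∑ a, w (a, b) with hv
  have hu0 : ∀ a, 0 ≤ u a := fun a => sub_nonneg.2 (h1 a)
  have hv0 : ∀ a, 0 ≤ v a := fun a => sub_nonneg.2 (h2 a)
  set M : α → ℝ := fun c => max (cellMass π u c) (cellMass π v c) with hM
  have hM0 : ∀ c, 0 ≤ M c := fun c => (cellMass_nonneg π hu0 c).trans (le_max_left _ _)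
  have hrow : ∀ a, ∑ b, (if π a = π b then u a * v b / M (π a) else 0) =
      u a * (cellMass π v (π a) / M (π a)) := by
    intro a
    unfold cellMass
    rw [Finset.sum_div, Finset.mul_sum]
    refine Finset.sum_congr rfl fun b _ => ?_
    by_cases h : π a = π b
    · rw [if_pos h, if_pos h.symm]; ring
    · rw [if_neg h, if_neg (Ne.symm h)]; simp
  have hcol : ∀ b, ∑ a, (if π a = π b then u a * v b / M (π a) else 0) =
      v b * (cellMass π u (π b) / M (π b)) := by
    intro b
    unfold cellMass
    rw [Finset.sum_div, Finset.mul_sum]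
    refine Finset.sum_congr rfl fun a _ => ?_
    by_cases h : π a = π b
    · rw [if_pos h, if_pos h, h]; ring
    · rw [if_neg h, if_neg h]; simp
  refine ⟨fun z => w z + if π z.1 = π z.2 then u z.1 * v z.2 / M (π z.1) else 0,
    fun z => ?_, fun a => ?_, fun b => ?_, fun a b h => ?_, ?_⟩
  · have := div_nonneg (mul_nonneg (hu0 z.1) (hv0 z.2)) (hM0 (π z.1))
    by_cases h : π z.1 = π z.2 <;> simp only [h, if_true, if_false] <;> simp_all
  · rw [Finset.sum_add_distrib, hrow, ← le_sub_iff_add_le']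
    exact mul_le_of_le_one_right (hu0 a) (div_le_one_of_le₀ (le_max_right _ _) (hM0 _))
  · rw [Finset.sum_add_distrib, hcol, ← le_sub_iff_add_le']
    exact mul_le_of_le_one_right (hv0 b) (div_le_one_of_le₀ (le_max_left _ _) (hM0 _))
  · simp only [hsupp a b h, if_neg h, add_zero]
  · -- the mass of `w` in a cell, computed from its rows and from its columns
    have hcell : ∀ c, cellMass π (fun a => ∑ b, w (a, b)) c =
        cellMass π (fun b => ∑ a, w (a, b)) c := by
      intro c
      have e1 : cellMass π (fun a => ∑ b, w (a, b)) c =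
          ∑ a, ∑ b, if π a = c then w (a, b) else 0 :=
        Finset.sum_congr rfl fun a _ => by split_ifs <;> simp
      have e2 : cellMass π (fun b => ∑ a, w (a, b)) c =
          ∑ b, ∑ a, if π b = c then w (a, b) else 0 :=
        Finset.sum_congr rfl fun a _ => by split_ifs <;> simp
      rw [e1, e2, Finset.sum_comm]
      refine Finset.sum_congr rfl fun b _ => Finset.sum_congr rfl fun a _ => ?_
      by_cases h : π a = π b
      · rw [h]
      · simp [hsupp a b h]
    have hμc : ∀ c, cellMass π μ c = cellMass π (fun a => ∑ b, w (a, b)) c + cellMass π u c := by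
      intro c; rw [← cellMass_add]; simp [hu]
    have hνc : ∀ c, cellMass π ν c = cellMass π (fun a => ∑ b, w (a, b)) c + cellMass π v c := by
      intro c; rw [hcell, ← cellMass_add]; simp [hv]
    rw [Fintype.sum_prod_type]
    simp only [Finset.sum_add_distrib, hrow]
    rw [← Finset.sum_add_distrib, ← sum_cellMass π, overlap]
    refine Finset.sum_le_sum fun c _ => ?_
    rw [cellMass_add, cellMass_mul π u (fun c => cellMass π v c / M c), hμc, hνc,
      min_add_add_left]
    refine add_le_add le_rfl ?_
    rcases (hM0 c).eq_or_lt with h | h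
    · rw [← h, div_zero, mul_zero]
      exact (min_le_left _ _).trans ((le_max_left _ _).trans h.symm.le)
    · rw [← mul_div_assoc, le_div_iff₀ h]
      exact (min_mul_max _ _).le

open Classical in
/-- The greedy matching after the levels `0, …, K`: the mass matched inside the cells of each level
is not lost at the later ones. -/
theorem exists_partial_coupling_levels {σ : ℕ → α → α}
    (hσ : ∀ k x y, σ k x = σ k y → σ (k + 1) x = σ (k + 1) y) {μ ν : α → ℝ}
    (hμ : ∀ x, 0 ≤ μ x) (hν : ∀ x, 0 ≤ ν x) (K : ℕ) :
    ∃ w : α × α → ℝ, (∀ z, 0 ≤ w z) ∧ (∀ a, ∑ b, w (a, b) ≤ μ a) ∧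
      (∀ b, ∑ a, w (a, b) ≤ ν b) ∧ (∀ a b, σ K a ≠ σ K b → w (a, b) = 0) ∧
      ∀ k ≤ K, overlap (σ k) μ ν ≤ ∑ z, w z * if σ k z.1 = σ k z.2 then 1 else 0 := by
  -- a partial coupling supported inside the cells has its whole mass inside the cells
  have hfull : ∀ (π : α → α) (w : α × α → ℝ), (∀ a b, π a ≠ π b → w (a, b) = 0) →
      ∑ z, w z = ∑ z, w z * if π z.1 = π z.2 then 1 else 0 := by
    intro π w h
    refine Finset.sum_congr rfl fun z _ => ?_
    split_ifs with h'
    · simp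
    · rw [mul_zero]; exact h _ _ h'
  induction K with
  | zero =>
    obtain ⟨w, hw, h1, h2, h3, h4⟩ := exists_exhausting_partial_coupling (σ 0) (μ := μ) (ν := ν)
      (w := fun _ => 0) (by simpa using hμ) (by simpa using hν)
      (fun _ _ _ => rfl)
    refine ⟨w, hw, h1, h2, h3, fun k hk => ?_⟩
    rw [Nat.le_zero.1 hk, ← hfull _ _ h3]
    exact h4
  | succ K ih =>
    obtain ⟨w, hw, h1, h2, h3, h4⟩ := ih
    obtain ⟨w', hw', h1', h2', h3', h4'⟩ := exists_exhausting_partial_coupling (σ (K + 1)) h1 h2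
      (fun a b h => h3 a b fun h' => h (hσ K a b h'))
    refine ⟨w', fun z => (hw z).trans (hw' z), h1', h2', h3', fun k hk => ?_⟩
    rcases Nat.le_succ_iff.1 hk with hk | rfl
    · refine (h4 k hk).trans (Finset.sum_le_sum fun z _ => mul_le_mul_of_nonneg_right (hw' z) ?_)
      split_ifs <;> norm_num
    · rw [← hfull _ _ h3']
      exact h4'

open Classical in
/-- For nested partitions, the coarsest of which is trivial, there is one coupling that splits as
few pairs as possible at all levels simultaneously. -/
theorem exists_coupling_levels {σ : ℕ → α → α}
    (hσ : ∀ k x y, σ k x = σ k y → σ (k + 1) x = σ (k + 1) y) {L : ℕ}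
    (hL : ∀ x y, σ L x = σ L y) {μ ν : α → ℝ} (hμ : μ ∈ stdSimplex ℝ α)
    (hν : ν ∈ stdSimplex ℝ α) :
    ∃ w ∈ couplings μ ν, ∀ k ≤ L, ∑ z, w z * (if σ k z.1 = σ k z.2 then 0 else 1) ≤
      1 / 2 * ∑ c, |cellMass (σ k) μ c - cellMass (σ k) ν c| := by
  obtain ⟨w, hw, h1, h2, h3, h4⟩ := exists_partial_coupling_levels hσ hμ.1 hν.1 L
  have hne : Nonempty α := by
    by_contra h
    rw [not_nonempty_iff] at h
    simpa using hμ.2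
  obtain ⟨x₀⟩ := hne
  have hmass : ∀ {μ : α → ℝ}, μ ∈ stdSimplex ℝ α → cellMass (σ L) μ (σ L x₀) = 1 := by
    intro μ hμ
    unfold cellMass
    simp only [hL _ x₀, if_true, hμ.2]
  have htot : 1 ≤ ∑ z, w z := by
    calc (1 : ℝ) = min (cellMass (σ L) μ (σ L x₀)) (cellMass (σ L) ν (σ L x₀)) := by
          rw [hmass hμ, hmass hν, min_self]
      _ ≤ overlap (σ L) μ ν := Finset.single_le_sum
          (f := fun c => min (cellMass (σ L) μ c) (cellMass (σ L) ν c))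
          (fun c _ => le_min (cellMass_nonneg _ hμ.1 c) (cellMass_nonneg _ hν.1 c))
          (Finset.mem_univ _)
      _ ≤ _ := h4 L le_rfl
      _ = ∑ z, w z := by simp [hL _ x₀]
  have hrow : ∀ a, ∑ b, w (a, b) = μ a := by
    have hle : ∑ a, μ a ≤ ∑ a, ∑ b, w (a, b) := by
      rw [hμ.2, ← Fintype.sum_prod_type]; exact htot
    intro a
    exact (Finset.sum_eq_sum_iff_of_le fun a _ => h1 a).1
      (le_antisymm (Finset.sum_le_sum fun a _ => h1 a) hle) a (Finset.mem_univ a)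
  have hcol : ∀ b, ∑ a, w (a, b) = ν b := by
    have hle : ∑ b, ν b ≤ ∑ b, ∑ a, w (a, b) := by
      rw [hν.2, Finset.sum_comm, ← Fintype.sum_prod_type]; exact htot
    intro a
    exact (Finset.sum_eq_sum_iff_of_le fun a _ => h2 a).1
      (le_antisymm (Finset.sum_le_sum fun a _ => h2 a) hle) a (Finset.mem_univ a)
  have hw1 : ∑ z, w z = 1 := by
    rw [Fintype.sum_prod_type]; simp only [hrow, hμ.2]
  refine ⟨w, ⟨⟨hw, hw1⟩, hrow, hcol⟩, fun k hk => ?_⟩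
  rw [← one_sub_overlap (σ k) hμ.2 hν.2]
  refine le_trans (le_of_eq ?_) (sub_le_sub_left (h4 k hk) 1)
  rw [eq_sub_iff_add_eq, ← Finset.sum_add_distrib]
  refine Eq.trans (Finset.sum_congr rfl fun z _ => ?_) hw1
  split_ifs <;> simp

end

section

variable {𝒳 : Type*} [Fintype 𝒳] [MetricSpace 𝒳] {p : ℝ}

/-- The transport cost of the greedy coupling. Here `Δ k` bounds the diameters of the cells of level
`k + 1`, so it bounds the cost of the pairs that are split at level `k` and joined at the next. -/
theorem wasserstein_rpow_le (hp : 1 ≤ p) {σ : ℕ → 𝒳 → 𝒳} (hσ0 : σ 0 = id)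
    (hσ : ∀ k x y, σ k x = σ k y → σ (k + 1) x = σ (k + 1) y) {L : ℕ}
    (hL : ∀ x y, σ L x = σ L y) {Δ : ℕ → ℝ} (hΔ0 : ∀ k, 0 ≤ Δ k)
    (hΔ : ∀ k < L, ∀ x y, σ (k + 1) x = σ (k + 1) y → dist x y ≤ Δ k)
    {μ ν : 𝒳 → ℝ} (hμ : μ ∈ stdSimplex ℝ 𝒳) (hν : ν ∈ stdSimplex ℝ 𝒳) :
    wasserstein p μ ν ^ p ≤ ∑ k ∈ Finset.range L,
      Δ k ^ p * (1 / 2 * ∑ c, |cellMass (σ k) μ c - cellMass (σ k) ν c|) := by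
  classical
  have hp0 : 0 < p := by positivity
  obtain ⟨w, hw, hlev⟩ := exists_coupling_levels hσ hL hμ hν
  have hcost := transportCost_nonneg (p := p) hw.1.1
  have h1 : wasserstein p μ ν ^ p ≤ transportCost p w := by
    calc _ ≤ (transportCost p w ^ (1 / p)) ^ p :=
          Real.rpow_le_rpow (wasserstein_nonneg _ _) (wasserstein_le_transportCost hp hw) hp0.le
      _ = _ := by rw [← Real.rpow_mul hcost, one_div_mul_cancel hp0.ne', Real.rpow_one]
  have hd : ∀ z : 𝒳 × 𝒳, dist z.1 z.2 ^ p ≤ ∑ k ∈ Finset.range L,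
      Δ k ^ p * if σ k z.1 = σ k z.2 then 0 else 1 := by
    intro z
    have hnn : ∀ k ∈ Finset.range L,
        0 ≤ Δ k ^ p * if σ k z.1 = σ k z.2 then (0 : ℝ) else 1 := fun k _ =>
      mul_nonneg (Real.rpow_nonneg (hΔ0 k) _) (by split_ifs <;> norm_num)
    -- the finest level at which the two points share a cell
    have hex : ∃ k, σ k z.1 = σ k z.2 := ⟨L, hL _ _⟩
    rcases hn : Nat.find hex with _ | k
    · have h0 := Nat.find_spec hex
      rw [hn, hσ0] at h0
      rw [show z.1 = z.2 from h0, dist_self, Real.zero_rpow hp0.ne']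
      simp
    · have h0 := Nat.find_spec hex
      rw [hn] at h0
      have hk : ¬ σ k z.1 = σ k z.2 := Nat.find_min hex (by omega)
      have hkL : k < L := by
        have := Nat.find_min' hex (hL z.1 z.2)
        omega
      refine le_trans ?_ (Finset.single_le_sum hnn (Finset.mem_range.2 hkL))
      rw [if_neg hk, mul_one]
      exact Real.rpow_le_rpow dist_nonneg (hΔ k hkL _ _ h0) hp0.le
  calc _ ≤ transportCost p w := h1
    _ ≤ ∑ z, w z * ∑ k ∈ Finset.range L, Δ k ^ p * if σ k z.1 = σ k z.2 then 0 else 1 := by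
        rw [transportCost_eq_sum]
        exact Finset.sum_le_sum fun z _ => mul_le_mul_of_nonneg_left (hd z) (hw.1.1 z)
    _ = ∑ k ∈ Finset.range L, Δ k ^ p * ∑ z, w z * if σ k z.1 = σ k z.2 then 0 else 1 := by
        simp only [Finset.mul_sum]
        rw [Finset.sum_comm]
        exact Finset.sum_congr rfl fun k _ => Finset.sum_congr rfl fun z _ => by ring
    _ ≤ _ := Finset.sum_le_sum fun k hk => mul_le_mul_of_nonneg_left
        (hlev k (Finset.mem_range.1 hk).le) (Real.rpow_nonneg (hΔ0 k) _)

/-! ### Nested partitions from minimal covers -/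

theorem exists_nearest_in_cover {δ : ℝ} (hδ : 0 ≤ δ) :
    ∃ ρ : 𝒳 → 𝒳, (∀ x, dist x (ρ x) ≤ δ) ∧ (Set.range ρ).ncard ≤ coveringNum 𝒳 δ := by
  have hfin : Metric.coveringNumber δ.toNNReal (Set.univ : Set 𝒳) ≠ ⊤ :=
    ne_top_of_le_ne_top (Set.encard_ne_top_iff.2 Set.finite_univ)
      (Metric.coveringNumber_le_encard_self _)
  obtain ⟨C, -, hCfin, hC, hcard⟩ := Metric.exists_set_encard_eq_coveringNumber hfin
  have : ∀ x, ∃ c ∈ C, dist x c ≤ δ := by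
    intro x
    obtain ⟨c, hc, h⟩ := hC (Set.mem_univ x)
    refine ⟨c, hc, ?_⟩
    have h' : edist x c ≤ (δ.toNNReal : ENNReal) := h
    rw [edist_nndist, ENNReal.coe_le_coe] at h'
    have := NNReal.coe_le_coe.2 h'
    rwa [coe_nndist, Real.coe_toNNReal δ hδ] at this
  choose ρ hρC hρ using this
  refine ⟨ρ, hρ, ?_⟩
  calc _ ≤ C.ncard := Set.ncard_le_ncard (Set.range_subset_iff.2 hρC) hCfin
    _ = _ := by rw [coveringNum, ← hcard]; rfl

/-- Nested partitions, given by maps to representatives. Level `0` consists of singletons, and level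
`k ≥ 1` comes from a minimal cover by balls of radius `q⁻ˡ diam 𝒳` with `l = lmax + 1 - k`,
whose centres are grouped at the next level like points; level `lmax + 1` has a single cell. -/
theorem exists_nested_partitions [Nonempty 𝒳] {q : ℕ} (hq : 2 ≤ q) (lmax : ℕ) :
    ∃ σ : ℕ → 𝒳 → 𝒳, σ 0 = id ∧ (∀ k x y, σ k x = σ k y → σ (k + 1) x = σ (k + 1) y) ∧
      (∀ x y, σ (lmax + 1) x = σ (lmax + 1) y) ∧
      (∀ k < lmax + 1, ∀ x y, σ (k + 1) x = σ (k + 1) y →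
        dist x y ≤ 2 * Metric.diam (Set.univ : Set 𝒳) * q * ((q : ℝ) ^ (lmax - k))⁻¹) ∧
      ∀ k < lmax, (Set.range (σ (k + 1))).ncard ≤
        coveringNum 𝒳 (((q : ℝ) ^ (lmax - k))⁻¹ * Metric.diam (Set.univ : Set 𝒳)) := by
  set D := Metric.diam (Set.univ : Set 𝒳)
  have hD : 0 ≤ D := Metric.diam_nonneg
  have hq' : (2 : ℝ) ≤ q := by exact_mod_cast hq
  have hq0 : (0 : ℝ) < q := by linarith
  obtain ⟨x₀⟩ := ‹Nonempty 𝒳›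
  have hρ : ∀ k, ∃ ρ : 𝒳 → 𝒳, (∀ x, dist x (ρ x) ≤ ((q : ℝ) ^ (lmax - k))⁻¹ * D) ∧
      (lmax ≤ k → ∀ x, ρ x = x₀) ∧
      (k < lmax → (Set.range ρ).ncard ≤ coveringNum 𝒳 (((q : ℝ) ^ (lmax - k))⁻¹ * D)) := by
    intro k
    rcases lt_or_ge k lmax with h | h
    · obtain ⟨ρ, h1, h2⟩ := exists_nearest_in_cover (𝒳 := 𝒳)
        (δ := ((q : ℝ) ^ (lmax - k))⁻¹ * D) (by positivity)
      exact ⟨ρ, h1, fun h' => absurd h (not_lt.2 h'), fun _ => h2⟩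
    · refine ⟨fun _ => x₀, fun x => ?_, fun _ _ => rfl, fun h' => absurd h' (not_lt.2 h)⟩
      rw [Nat.sub_eq_zero_of_le h]
      simpa using dist_le_diam_univ x x₀
  choose ρ hρ1 hρ2 hρ3 using hρ
  let σ : ℕ → 𝒳 → 𝒳 := fun k => Nat.rec id (fun k s x => ρ k (s x)) k
  have hσ : ∀ k x, σ (k + 1) x = ρ k (σ k x) := fun k x => rfl
  have hdist : ∀ k < lmax + 1, ∀ x, dist x (σ (k + 1) x) ≤ D * q * ((q : ℝ) ^ (lmax - k))⁻¹ := by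
    intro k
    induction k with
    | zero =>
      intro _ x
      refine (hρ1 0 x).trans ?_
      have : 0 ≤ ((q : ℝ) ^ (lmax - 0))⁻¹ * D := by positivity
      nlinarith
    | succ k ih =>
      intro hk x
      have h1 := ih (by omega) x
      have h2 := hρ1 (k + 1) (σ (k + 1) x)
      rw [← hσ] at h2
      have h3 := dist_triangle x (σ (k + 1) x) (σ (k + 1 + 1) x)
      have h4 : lmax - k = lmax - (k + 1) + 1 := by omega
      have h5 : D * q * ((q : ℝ) ^ (lmax - k))⁻¹ = ((q : ℝ) ^ (lmax - (k + 1)))⁻¹ * D := by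
        rw [h4, pow_succ]; field_simp
      have : 0 ≤ ((q : ℝ) ^ (lmax - (k + 1)))⁻¹ * D := by positivity
      nlinarith
  refine ⟨σ, rfl, fun k x y h => ?_, fun x y => ?_, fun k hk x y h => ?_, fun k hk => ?_⟩
  · rw [hσ, hσ, h]
  · rw [hσ, hσ, hρ2 lmax le_rfl, hρ2 lmax le_rfl]
  · have h1 := hdist k hk x
    have h2 := hdist k hk y
    rw [← h] at h2
    have := dist_triangle_right x y (σ (k + 1) x)
    linarith
  · refine le_trans (Set.ncard_le_ncard ?_ (Set.toFinite _)) (hρ3 k hk)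
    rintro _ ⟨x, rfl⟩
    exact ⟨σ k x, rfl⟩

end

/-! ### The mean of the empirical Wasserstein distance -/

section

variable {𝒳 : Type*} [Fintype 𝒳] {r : 𝒳 → ℝ}

/-- Cauchy–Schwarz; only the cells of points in the range of `π` are nonempty. -/
theorem sum_sqrt_cellMass_le (hr : r ∈ stdSimplex ℝ 𝒳) (π : 𝒳 → 𝒳) :
    ∑ c, √(cellMass π r c) ≤ √((Set.range π).ncard : ℝ) := by
  classical
  have hzero : ∀ c ∉ Finset.univ.image π, √(cellMass π r c) = 0 := by
    intro c hc
    have : cellMass π r c = 0 := Finset.sum_eq_zero fun x _ =>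
      if_neg fun h => hc (Finset.mem_image.2 ⟨x, Finset.mem_univ x, h⟩)
    rw [this, Real.sqrt_zero]
  rw [← Finset.sum_subset (Finset.subset_univ (Finset.univ.image π)) fun c _ hc => hzero c hc]
  have h := Real.sum_sqrt_mul_sqrt_le (Finset.univ.image π) (f := fun c => cellMass π r c)
    (g := fun _ => 1) (fun c => cellMass_nonneg π hr.1 c) (fun _ => zero_le_one)
  simp only [Real.sqrt_one, mul_one, Finset.sum_const, nsmul_eq_mul] at h
  refine h.trans ?_
  have h1 : ∑ c ∈ Finset.univ.image π, cellMass π r c ≤ 1 := by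
    rw [← hr.2, ← sum_cellMass π r]
    exact Finset.sum_le_sum_of_subset_of_nonneg (Finset.subset_univ _) fun c _ _ =>
      cellMass_nonneg π hr.1 c
  have h2 : (Set.range π).ncard = (Finset.univ.image π).card := by
    rw [← Set.ncard_coe_finset]; simp
  rw [h2]
  exact mul_le_of_le_one_left (Real.sqrt_nonneg _) (Real.sqrt_le_one.2 h1)

variable [MetricSpace 𝒳] {p : ℝ}

theorem errorConst_nonneg (q lmax : ℕ) : 0 ≤ errorConst 𝒳 p q lmax := by
  have hD : 0 ≤ Metric.diam (Set.univ : Set 𝒳) := Metric.diam_nonneg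
  unfold errorConst
  refine mul_nonneg (by positivity) (add_nonneg (by positivity) (Finset.sum_nonneg fun l _ => ?_))
  positivity

/-- The cell diameters and cell numbers of the partitions in `exists_nested_partitions` produce
the error constant; its summand with `l = 0` is not used. -/
theorem level_sum_le_errorConst {q : ℕ} (hq : 2 ≤ q) (lmax : ℕ) {N : ℕ → ℕ}
    (hN0 : N 0 ≤ Fintype.card 𝒳) (hN : ∀ k < lmax, N (k + 1) ≤
      coveringNum 𝒳 (((q : ℝ) ^ (lmax - k))⁻¹ * Metric.diam (Set.univ : Set 𝒳))) :
    ∑ k ∈ Finset.range (lmax + 1),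
      (2 * Metric.diam (Set.univ : Set 𝒳) * q * ((q : ℝ) ^ (lmax - k))⁻¹) ^ p *
        (1 / 2 * √(N k : ℝ)) ≤ errorConst 𝒳 p q lmax := by
  set D := Metric.diam (Set.univ : Set 𝒳) with hDdef
  have hD : 0 ≤ D := Metric.diam_nonneg
  have hq0 : (0 : ℝ) < q := by positivity
  set C := 2 ^ (p - 1) * (q : ℝ) ^ (2 * p) * D ^ p with hC
  have hC0 : 0 ≤ C := by positivity
  have hcoef : ∀ l : ℕ, (2 * D * q * ((q : ℝ) ^ l)⁻¹) ^ p * (1 / 2) =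
      C * (q : ℝ) ^ (-(((l : ℝ) + 1) * p)) := by
    intro l
    rw [Real.mul_rpow (by positivity) (by positivity), Real.mul_rpow (by positivity) hq0.le,
      Real.mul_rpow (by norm_num) hD, hC, Real.rpow_sub (by norm_num), Real.rpow_one,
      ← Real.rpow_natCast, ← Real.rpow_neg hq0.le, ← Real.rpow_mul hq0.le]
    have : (q : ℝ) ^ (2 * p) * (q : ℝ) ^ (-(((l : ℝ) + 1) * p)) =
        (q : ℝ) ^ p * (q : ℝ) ^ (-(l : ℝ) * p) := by
      rw [← Real.rpow_add hq0, ← Real.rpow_add hq0]; congr 1; ring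
    calc _ = 2 ^ p / 2 * D ^ p * ((q : ℝ) ^ p * (q : ℝ) ^ (-(l : ℝ) * p)) := by ring
      _ = _ := by rw [← this]; ring
  have hterm : ∀ l n : ℕ, (2 * D * q * ((q : ℝ) ^ l)⁻¹) ^ p * (1 / 2 * √(n : ℝ)) =
      C * ((q : ℝ) ^ (-(((l : ℝ) + 1) * p)) * √(n : ℝ)) := by
    intro l n
    rw [← mul_assoc, hcoef, mul_assoc]
  simp only [hterm]
  rw [← Finset.mul_sum]
  unfold errorConst
  rw [← hDdef, ← hC]
  refine mul_le_mul_of_nonneg_left ?_ hC0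
  rw [Finset.sum_range_succ', Finset.sum_range_succ' _ lmax, add_comm]
  refine add_le_add ?_ ?_
  · rw [Nat.sub_zero]
    gcongr
  · refine le_add_of_le_of_nonneg ?_ (by positivity)
    rw [← Finset.sum_range_reflect]
    refine Finset.sum_le_sum fun k hk => ?_
    have hk' := Finset.mem_range.1 hk
    have e1 : lmax - (lmax - 1 - k + 1) = k := by omega
    have e2 : lmax - (lmax - 1 - k) = k + 1 := by omega
    have h := hN (lmax - 1 - k) (by omega)
    rw [e2] at h
    rw [e1]
    push_cast
    gcongr

end

section

variable {Ω : Type*} [MeasurableSpace Ω] {P : Measure Ω} [IsProbabilityMeasure P]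

theorem integrable_comp_of_finite {β : Type*} [Finite β] [MeasurableSpace β]
    [MeasurableSingletonClass β] {U : Ω → β} (hU : Measurable U) (F : β → ℝ) :
    Integrable (fun ω => F (U ω)) P := by
  have := Measure.isProbabilityMeasure_map (μ := P) hU.aemeasurable
  exact (Integrable.of_finite (μ := P.map U) (f := F)).comp_measurable hU

theorem integral_comp_eq_sum {β : Type*} [Fintype β] [MeasurableSpace β]
    [MeasurableSingletonClass β] {U : Ω → β} (hU : Measurable U) (F : β → ℝ) :
    ∫ ω, F (U ω) ∂P = ∑ u, P.real (U ⁻¹' {u}) * F u := by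
  have := Measure.isProbabilityMeasure_map (μ := P) hU.aemeasurable
  rw [← integral_map (f := F) hU.aemeasurable (measurable_of_finite F).aestronglyMeasurable,
    integral_fintype (Integrable.of_finite)]
  refine Finset.sum_congr rfl fun u _ => ?_
  rw [map_measureReal_apply hU (measurableSet_singleton u), smul_eq_mul]

theorem sum_measureReal_fiber {β : Type*} [Fintype β] [MeasurableSpace β]
    [MeasurableSingletonClass β] {U : Ω → β} (hU : Measurable U) :
    ∑ u, P.real (U ⁻¹' {u}) = 1 := by
  have := integral_comp_eq_sum (P := P) hU fun _ => 1
  simpa using this.symm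

theorem integral_abs_sub_integral_le {V : Ω → ℝ} (hV : MemLp V 2 P) :
    ∫ ω, |V ω - ∫ ω', V ω' ∂P| ∂P ≤ √(variance V P) := by
  set m := ∫ ω', V ω' ∂P
  have h1 : MemLp (fun ω => |V ω - m|) 2 P := (hV.sub (memLp_const m)).abs
  have h2 := variance_nonneg (fun ω => |V ω - m|) P
  rw [variance_eq_sub h1] at h2
  refine Real.le_sqrt_of_sq_le ?_
  rw [variance_eq_integral hV.aemeasurable]
  have h3 : ∫ ω, ((fun ω => |V ω - m|) ^ 2) ω ∂P = ∫ ω, (V ω - m) ^ 2 ∂P := by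
    simp
  linarith

variable {𝒳 : Type*} [Fintype 𝒳] [MeasurableSpace 𝒳] [MeasurableSingletonClass 𝒳] {S : ℕ}
  {X : Fin S → Ω → 𝒳} {r : 𝒳 → ℝ}

/-- The standard deviation of the empirical frequency of a cell bounds its mean error. -/
theorem integral_abs_cellMass_empirical_sub_le (hS : 1 ≤ S) (hX : ∀ j, Measurable (X j))
    (hlaw : ∀ j x, P.real (X j ⁻¹' {x}) = r x) (hind : iIndepFun X P)
    (π : 𝒳 → 𝒳) (c : 𝒳) :
    ∫ ω, |cellMass π (empirical fun j => X j ω) c - cellMass π r c| ∂P ≤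
      √(cellMass π r c) * (√S)⁻¹ := by
  classical
  set g : 𝒳 → ℝ := fun a => if π a = c then 1 else 0 with hg
  have hgm : Measurable g := measurable_of_finite g
  have hcell : ∀ μ : 𝒳 → ℝ, cellMass π μ c = ∑ a, μ a * g a := by
    intro μ
    unfold cellMass
    exact Finset.sum_congr rfl fun a _ => by simp only [hg]; split_ifs <;> simp
  set m := cellMass π r c with hm
  have hS0 : (0 : ℝ) < S := by positivity
  have hmem : ∀ j, MemLp (fun ω => g (X j ω)) 2 P := by
    intro j
    refine MemLp.of_bound (hgm.comp (hX j)).aestronglyMeasurable 1 (ae_of_all _ fun ω => ?_)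
    simp only [hg]; split_ifs <;> simp
  have hmean : ∀ j, ∫ ω, g (X j ω) ∂P = m := by
    intro j
    rw [integral_comp_eq_sum (hX j), hm, hcell]
    simp only [hlaw]
  have hvar : ∀ j, variance (fun ω => g (X j ω)) P ≤ m := by
    intro j
    refine (variance_le_expectation_sq (hmem j).aestronglyMeasurable).trans_eq ?_
    rw [← hmean j]
    refine integral_congr_ae (ae_of_all _ fun ω => ?_)
    simp only [hg, Pi.pow_apply]; split_ifs <;> simp
  set V : Ω → ℝ := ∑ j, fun ω => g (X j ω) with hVdef
  have hVm : MemLp V 2 P := memLp_finsetSum' _ fun j _ => hmem j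
  have hVvar : variance V P ≤ S * m := by
    rw [hVdef, IndepFun.variance_sum (fun j _ => hmem j)]
    · refine (Finset.sum_le_sum fun j _ => hvar j).trans_eq ?_
      simp
    · intro i _ j _ hij
      exact (hind.indepFun hij).comp hgm hgm
  have hVmean : ∫ ω, V ω ∂P = S * m := by
    simp only [hVdef, Finset.sum_apply]
    rw [integral_finsetSum _ fun j _ => (hmem j).integrable (by norm_num)]
    simp [hmean]
  have hV := integral_abs_sub_integral_le hVm
  rw [hVmean] at hV
  have hemp : ∀ ω, |cellMass π (empirical fun j => X j ω) c - m| = (S : ℝ)⁻¹ * |V ω - S * m| := by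
    intro ω
    rw [hcell, sum_empirical_mul, ← abs_of_pos (inv_pos.2 hS0), ← abs_mul, abs_of_pos
      (inv_pos.2 hS0)]
    congr 1
    simp only [hVdef, Finset.sum_apply]
    field_simp
  simp only [hemp]
  rw [integral_const_mul]
  calc (S : ℝ)⁻¹ * ∫ ω, |V ω - S * m| ∂P ≤ (S : ℝ)⁻¹ * √(S * m) := by
        refine mul_le_mul_of_nonneg_left (hV.trans (Real.sqrt_le_sqrt hVvar)) (by positivity)
    _ = √m * (√S)⁻¹ := by
        rw [Real.sqrt_mul hS0.le]
        have : √(S : ℝ) ≠ 0 := (Real.sqrt_pos.2 hS0).ne'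
        nth_rewrite 1 [← Real.mul_self_sqrt hS0.le]
        field_simp

variable [MetricSpace 𝒳] {p : ℝ}

/-- The bound for the mean of the `p`-th power: the mean error of the frequencies at each level is
at most `√(number of cells / S)`. -/
theorem integral_wasserstein_rpow_le (hp : 1 ≤ p) (hS : 1 ≤ S) (hX : ∀ j, Measurable (X j))
    (hr : r ∈ stdSimplex ℝ 𝒳) (hlaw : ∀ j x, P.real (X j ⁻¹' {x}) = r x) (hind : iIndepFun X P)
    {q : ℕ} (hq : 2 ≤ q) (lmax : ℕ) :
    ∫ ω, wasserstein p (empirical fun j => X j ω) r ^ p ∂P ≤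
      errorConst 𝒳 p q lmax * (√S)⁻¹ := by
  have hne : Nonempty 𝒳 := by
    by_contra h
    rw [not_nonempty_iff] at h
    simpa using hr.2
  obtain ⟨σ, hσ0, hσ, hσL, hσd, hσN⟩ := exists_nested_partitions (𝒳 := 𝒳) hq lmax
  have hU : Measurable fun ω => fun j => X j ω := measurable_pi_lambda _ hX
  have hint : ∀ F : (Fin S → 𝒳) → ℝ, Integrable (fun ω => F fun j => X j ω) P := fun F =>
    integrable_comp_of_finite hU F
  set Δ : ℕ → ℝ := fun k =>
    2 * Metric.diam (Set.univ : Set 𝒳) * q * ((q : ℝ) ^ (lmax - k))⁻¹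
  have hΔ0 : ∀ k, 0 ≤ Δ k := fun k => mul_nonneg (mul_nonneg (mul_nonneg zero_le_two
    Metric.diam_nonneg) (Nat.cast_nonneg _)) (by positivity)
  have hΔp : ∀ k, 0 ≤ Δ k ^ p := fun k => Real.rpow_nonneg (hΔ0 k) p
  calc _ ≤ ∫ ω, ∑ k ∈ Finset.range (lmax + 1), Δ k ^ p * (1 / 2 * ∑ c,
          |cellMass (σ k) (empirical fun j => X j ω) c - cellMass (σ k) r c|) ∂P :=
        integral_mono (hint fun x => wasserstein p (empirical x) r ^ p)
          (hint fun x => ∑ k ∈ Finset.range (lmax + 1), Δ k ^ p * (1 / 2 * ∑ c,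
            |cellMass (σ k) (empirical x) c - cellMass (σ k) r c|))
          fun ω => wasserstein_rpow_le hp hσ0 hσ hσL hΔ0 hσd (empirical_mem_stdSimplex hS _) hr
    _ = ∑ k ∈ Finset.range (lmax + 1), Δ k ^ p * (1 / 2 * ∑ c,
          ∫ ω, |cellMass (σ k) (empirical fun j => X j ω) c - cellMass (σ k) r c| ∂P) := by
        rw [integral_finsetSum _ fun k _ => hint fun x => Δ k ^ p * (1 / 2 * ∑ c,
            |cellMass (σ k) (empirical x) c - cellMass (σ k) r c|)]
        refine Finset.sum_congr rfl fun k _ => ?_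
        rw [integral_const_mul, integral_const_mul, integral_finsetSum _ fun c _ =>
          hint fun x => |cellMass (σ k) (empirical x) c - cellMass (σ k) r c|]
    _ ≤ ∑ k ∈ Finset.range (lmax + 1), Δ k ^ p *
          (1 / 2 * √((Set.range (σ k)).ncard : ℝ)) * (√S)⁻¹ := by
        refine Finset.sum_le_sum fun k _ => ?_
        rw [mul_assoc, mul_assoc (1 / 2 : ℝ)]
        refine mul_le_mul_of_nonneg_left (mul_le_mul_of_nonneg_left ?_ (by norm_num)) (hΔp k)
        refine (Finset.sum_le_sum fun c _ =>
          integral_abs_cellMass_empirical_sub_le hS hX hlaw hind (σ k) c).trans ?_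
        rw [← Finset.sum_mul]
        exact mul_le_mul_of_nonneg_right (sum_sqrt_cellMass_le hr (σ k)) (by positivity)
    _ ≤ _ := by
        rw [← Finset.sum_mul]
        refine mul_le_mul_of_nonneg_right ?_ (by positivity)
        refine level_sum_le_errorConst hq lmax (N := fun k => (Set.range (σ k)).ncard) ?_ hσN
        simp [hσ0, Set.ncard_univ, Nat.card_eq_fintype_card]

theorem integral_wasserstein_le (hp : 1 ≤ p) (hS : 1 ≤ S) (hX : ∀ j, Measurable (X j))
    (hr : r ∈ stdSimplex ℝ 𝒳) (hlaw : ∀ j x, P.real (X j ⁻¹' {x}) = r x) (hind : iIndepFun X P)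
    {q : ℕ} (hq : 2 ≤ q) (lmax : ℕ) :
    ∫ ω, wasserstein p (empirical fun j => X j ω) r ∂P ≤
      errorConst 𝒳 p q lmax ^ (1 / p) * (S : ℝ) ^ (-(1 / (2 * p))) := by
  have hU : Measurable fun ω => fun j => X j ω := measurable_pi_lambda _ hX
  have h := integral_wasserstein_rpow_le hp hS hX hr hlaw hind hq lmax
  rw [integral_comp_eq_sum hU fun x => wasserstein p (empirical x) r ^ p] at h
  rw [integral_comp_eq_sum hU fun x => wasserstein p (empirical x) r]
  refine (Real.arith_mean_le_rpow_mean Finset.univ _ _ (fun _ _ => measureReal_nonneg)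
    (sum_measureReal_fiber hU) (fun x _ => wasserstein_nonneg _ _) hp).trans ?_
  refine (Real.rpow_le_rpow (Finset.sum_nonneg fun x _ => mul_nonneg measureReal_nonneg
    (Real.rpow_nonneg (wasserstein_nonneg _ _) _)) h (by positivity)).trans_eq ?_
  rw [Real.mul_rpow (errorConst_nonneg q lmax) (by positivity), Real.sqrt_eq_rpow,
    ← Real.rpow_neg (by positivity), ← Real.rpow_mul (by positivity)]
  congr 2
  field_simp

end

/-! ### Concentration of the subsampled distance -/

section

variable {𝒳 : Type*} {p : ℝ} {B S : ℕ}

theorem ham_sum_eq (u u' : (Fin B × Fin S) ⊕ (Fin B × Fin S) → 𝒳) :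
    ham u u' = ∑ i, (ham (fun j => u (Sum.inl (i, j))) (fun j => u' (Sum.inl (i, j))) +
      ham (fun j => u (Sum.inr (i, j))) (fun j => u' (Sum.inr (i, j)))) := by
  unfold ham
  rw [Fintype.sum_sum_type, Fintype.sum_prod_type, Fintype.sum_prod_type,
    Finset.sum_add_distrib]

variable [Fintype 𝒳] [MetricSpace 𝒳]

/-- The subsampled distance as a function of all `2 * S * B` sample points. -/
def subsampledJoint (p : ℝ) (u : (Fin B × Fin S) ⊕ (Fin B × Fin S) → 𝒳) : ℝ :=
  subsampledWasserstein p (fun i j => u (Sum.inl (i, j))) (fun i j => u (Sum.inr (i, j)))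

/-- Hölder continuity of the subsampled distance. Averaging over the repetitions keeps the
modulus of continuity, as `t ↦ t ^ (1 / p)` is concave. -/
theorem abs_subsampledJoint_sub_le (hp : 1 ≤ p) (hS : 1 ≤ S) (hB : 1 ≤ B)
    (u u' : (Fin B × Fin S) ⊕ (Fin B × Fin S) → 𝒳) :
    |subsampledJoint p u - subsampledJoint p u'| ≤
      Metric.diam (Set.univ : Set 𝒳) * (ham u u' / (S * B)) ^ (1 / p) := by
  have hB0 : (0 : ℝ) < B := by positivity
  have hS0 : (0 : ℝ) < S := by positivity
  have hp0 : 0 < p := by positivity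
  set D := Metric.diam (Set.univ : Set 𝒳)
  have hD : 0 ≤ D := Metric.diam_nonneg
  set h : Fin B → ℝ := fun i =>
    ham (fun j => u (Sum.inl (i, j))) (fun j => u' (Sum.inl (i, j))) +
      ham (fun j => u (Sum.inr (i, j))) (fun j => u' (Sum.inr (i, j))) with hh
  have hh0 : ∀ i, 0 ≤ h i / S := fun i =>
    div_nonneg (add_nonneg (ham_nonneg _ _) (ham_nonneg _ _)) hS0.le
  unfold subsampledJoint subsampledWasserstein
  rw [← mul_sub, abs_mul, abs_of_pos (inv_pos.2 hB0), ← Finset.sum_sub_distrib]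
  calc _ ≤ (B : ℝ)⁻¹ * ∑ i, D * (h i / S) ^ (1 / p) := by
        refine mul_le_mul_of_nonneg_left ((Finset.abs_sum_le_sum_abs _ _).trans
          (Finset.sum_le_sum fun i _ => ?_)) (by positivity)
        exact abs_wasserstein_empirical_sub_le hp hS _ _ _ _
    _ = D * ∑ i, (B : ℝ)⁻¹ * (h i / S) ^ (1 / p) := by
        rw [← Finset.mul_sum, ← Finset.mul_sum]; ring
    _ ≤ D * (∑ i, (B : ℝ)⁻¹ * ((h i / S) ^ (1 / p)) ^ p) ^ (1 / p) := by
        refine mul_le_mul_of_nonneg_left (Real.arith_mean_le_rpow_mean _ _ _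
          (fun _ _ => by positivity) (by simp [hB0.ne'])
          (fun i _ => Real.rpow_nonneg (hh0 i) _) hp) hD
    _ = _ := by
        congr 2
        rw [ham_sum_eq, Finset.sum_div]
        refine Finset.sum_congr rfl fun i _ => ?_
        rw [← Real.rpow_mul (hh0 i), one_div_mul_cancel hp0.ne', Real.rpow_one, hh]
        field_simp

theorem abs_subsampled_sub_le (hp : 1 ≤ p) (hS : 1 ≤ S) (hB : 1 ≤ B) {r s : 𝒳 → ℝ}
    (hr : r ∈ stdSimplex ℝ 𝒳) (hs : s ∈ stdSimplex ℝ 𝒳) (x y : Fin B → Fin S → 𝒳) :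
    |subsampledWasserstein p x y - wasserstein p r s| ≤
      (B : ℝ)⁻¹ * ∑ i, (wasserstein p (empirical (x i)) r + wasserstein p (empirical (y i)) s) := by
  have hB0 : (0 : ℝ) < B := by positivity
  have : wasserstein p r s = (B : ℝ)⁻¹ * ∑ _i : Fin B, wasserstein p r s := by
    simp [hB0.ne']
  unfold subsampledWasserstein
  rw [this, ← mul_sub, abs_mul, abs_of_pos (inv_pos.2 hB0), ← Finset.sum_sub_distrib]
  refine mul_le_mul_of_nonneg_left ((Finset.abs_sum_le_sum_abs _ _).trans
    (Finset.sum_le_sum fun i _ => ?_)) (by positivity)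
  have hx := empirical_mem_stdSimplex hS (x i)
  have hy := empirical_mem_stdSimplex hS (y i)
  have h1 := wasserstein_triangle hp hr hx hs hy
  have h2 := wasserstein_triangle hp hx hr hy hs
  rw [wasserstein_comm s] at h1
  rw [wasserstein_comm r (empirical _)] at h2
  rw [abs_sub_le_iff]
  constructor <;> linarith

/-- Concentration for a function `T` on a finite product space that is Hölder continuous with
exponent `1 / p` in the Hamming distance `ham`. If `f` is the distance to the set `A` on which `T`
exceeds `m` by `z`, then `z + m ≤ T + D (f / M)^(1/p)` everywhere. Integrating this and using
Jensen's inequality gives `z ≤ D (E f / M)^(1/p)`, so that `A` is far away on average, and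
the bound for `f` applies. -/
theorem sum_prodWeight_le_of_holder {ι α : Type*} [Fintype ι] [DecidableEq ι] [Nonempty ι]
    [Fintype α] {v : ι → α → ℝ} (hv : ∀ k, v k ∈ stdSimplex ℝ α) (hp : 1 ≤ p) {D M : ℝ}
    (hD : 0 < D) (hM : 0 < M) {T : (ι → α) → ℝ}
    (hT : ∀ u u', T u ≤ T u' + D * (ham u' u / M) ^ (1 / p)) {m : ℝ}
    (hm : ∑ u, prodWeight v u * T u ≤ m) {z : ℝ} (hz : 0 ≤ z) {A : Finset (ι → α)}
    (hA : ∀ u ∈ A, z + m ≤ T u) :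
    ∑ u ∈ A, prodWeight v u ≤
      Real.exp (-(M ^ 2 * (z ^ (2 * p) / D ^ (2 * p)) / (2 * Fintype.card ι))) := by
  have hp0 : 0 < p := by positivity
  rcases A.eq_empty_or_nonempty with rfl | hne
  · simpa using Real.exp_nonneg _
  obtain ⟨f, hf0, hfA, hP⟩ := exists_distance_to hv hne
  have hw := prodWeight_nonneg fun k => (hv k).1
  have hw1 := sum_prodWeight hv
  set F := ∑ u, prodWeight v u * f u with hF
  have hF0 : 0 ≤ F := Finset.sum_nonneg fun u _ => mul_nonneg (hw u) (hf0 u)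
  have hfM : ∀ u, 0 ≤ f u / M := fun u => div_nonneg (hf0 u) hM.le
  have hpoint : ∀ u, z + m ≤ T u + D * (f u / M) ^ (1 / p) := by
    intro u
    obtain ⟨a, ha, hau⟩ := hfA u
    rw [hau]
    exact (hA a ha).trans (hT a u)
  have hjensen : ∑ u, prodWeight v u * (f u / M) ^ (1 / p) ≤ (F / M) ^ (1 / p) := by
    refine (Real.arith_mean_le_rpow_mean _ _ _ (fun u _ => hw u) hw1
      (fun u _ => Real.rpow_nonneg (hfM u) _) hp).trans_eq ?_
    congr 1
    rw [hF, Finset.sum_div]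
    refine Finset.sum_congr rfl fun u _ => ?_
    rw [← Real.rpow_mul (hfM u), one_div_mul_cancel hp0.ne', Real.rpow_one, mul_div_assoc]
  have hzF : z ≤ D * (F / M) ^ (1 / p) := by
    have h1 : z + m ≤ ∑ u, prodWeight v u * T u +
        D * ∑ u, prodWeight v u * (f u / M) ^ (1 / p) := by
      calc z + m = ∑ u, prodWeight v u * (z + m) := by rw [← Finset.sum_mul, hw1, one_mul]
        _ ≤ ∑ u, prodWeight v u * (T u + D * (f u / M) ^ (1 / p)) :=
            Finset.sum_le_sum fun u _ => mul_le_mul_of_nonneg_left (hpoint u) (hw u)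
        _ = _ := by
            rw [Finset.mul_sum, ← Finset.sum_add_distrib]
            exact Finset.sum_congr rfl fun u _ => by ring
    have h2 := mul_le_mul_of_nonneg_left hjensen hD.le
    linarith
  have hzF2 : z ^ (2 * p) / D ^ (2 * p) ≤ (F / M) ^ 2 := by
    rw [← Real.div_rpow hz hD.le]
    have h3 : z / D ≤ (F / M) ^ (1 / p) := by rwa [div_le_iff₀' hD]
    calc (z / D) ^ (2 * p) ≤ ((F / M) ^ (1 / p)) ^ (2 * p) :=
          Real.rpow_le_rpow (by positivity) h3 (by positivity)
      _ = (F / M) ^ 2 := by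
          rw [← Real.rpow_mul (by positivity), ← Real.rpow_natCast]
          congr 1; push_cast; field_simp
  refine hP.trans (Real.exp_le_exp.2 ?_)
  rw [neg_div]
  refine neg_le_neg (div_le_div_of_nonneg_right ?_ (by positivity))
  calc M ^ 2 * (z ^ (2 * p) / D ^ (2 * p)) ≤ M ^ 2 * (F / M) ^ 2 :=
        mul_le_mul_of_nonneg_left hzF2 (by positivity)
    _ = F ^ 2 := by field_simp

end

section

variable {Ω : Type*} [MeasurableSpace Ω] {P : Measure Ω}

/-- The mean deviation of the subsampled distance. The integrands are compared pointwise by the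
triangle inequality, so that only independence within each sample is needed. -/
theorem integral_abs_subsampled_sub_le [IsProbabilityMeasure P] {𝒳 : Type*} [Fintype 𝒳]
    [MetricSpace 𝒳] [MeasurableSpace 𝒳] [MeasurableSingletonClass 𝒳] {p : ℝ} (hp : 1 ≤ p)
    {r s : 𝒳 → ℝ} (hr : r ∈ stdSimplex ℝ 𝒳) (hs : s ∈ stdSimplex ℝ 𝒳) {S B : ℕ} (hS : 1 ≤ S)
    (hB : 1 ≤ B) {X Y : Fin B → Fin S → Ω → 𝒳} (hX : ∀ i j, Measurable (X i j))
    (hY : ∀ i j, Measurable (Y i j)) (hXlaw : ∀ i j x, P.real (X i j ⁻¹' {x}) = r x)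
    (hYlaw : ∀ i j x, P.real (Y i j ⁻¹' {x}) = s x) (hindX : ∀ i, iIndepFun (X i) P)
    (hindY : ∀ i, iIndepFun (Y i) P) {q : ℕ} (hq : 2 ≤ q) (lmax : ℕ) :
    ∫ ω, |subsampledWasserstein p (fun i j => X i j ω) (fun i j => Y i j ω)
        - wasserstein p r s| ∂P ≤
      2 * errorConst 𝒳 p q lmax ^ (1 / p) * (S : ℝ) ^ (-(1 / (2 * p))) := by
  have hB0 : (0 : ℝ) < B := by positivity
  have hinX : ∀ i, Integrable (fun ω => wasserstein p (empirical fun j => X i j ω) r) P := fun i =>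
    integrable_comp_of_finite (measurable_pi_lambda _ (hX i))
      fun x => wasserstein p (empirical x) r
  have hinY : ∀ i, Integrable (fun ω => wasserstein p (empirical fun j => Y i j ω) s) P := fun i =>
    integrable_comp_of_finite (measurable_pi_lambda _ (hY i))
      fun x => wasserstein p (empirical x) s
  have hadd : ∀ i, Integrable (fun ω => wasserstein p (empirical fun j => X i j ω) r +
      wasserstein p (empirical fun j => Y i j ω) s) P := fun i => (hinX i).add (hinY i)
  have hbound : Integrable (fun ω => (B : ℝ)⁻¹ * ∑ i,
      (wasserstein p (empirical fun j => X i j ω) r +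
        wasserstein p (empirical fun j => Y i j ω) s)) P :=
    (integrable_finsetSum _ fun i _ => hadd i).const_mul _
  calc _ ≤ ∫ ω, (B : ℝ)⁻¹ * ∑ i, (wasserstein p (empirical fun j => X i j ω) r +
          wasserstein p (empirical fun j => Y i j ω) s) ∂P :=
        integral_mono_of_nonneg (ae_of_all _ fun ω => abs_nonneg _) hbound
          (ae_of_all _ fun ω => abs_subsampled_sub_le hp hS hB hr hs _ _)
    _ = (B : ℝ)⁻¹ * ∑ i, (∫ ω, wasserstein p (empirical fun j => X i j ω) r ∂P +
          ∫ ω, wasserstein p (empirical fun j => Y i j ω) s ∂P) := by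
        rw [integral_const_mul, integral_finsetSum _ fun i _ => hadd i]
        congr 1
        exact Finset.sum_congr rfl fun i _ => integral_add (hinX i) (hinY i)
    _ ≤ (B : ℝ)⁻¹ * ∑ _i : Fin B,
          2 * errorConst 𝒳 p q lmax ^ (1 / p) * (S : ℝ) ^ (-(1 / (2 * p))) := by
        refine mul_le_mul_of_nonneg_left (Finset.sum_le_sum fun i _ => ?_) (by positivity)
        have h1 := integral_wasserstein_le hp hS (hX i) hr (hXlaw i) (hindX i) hq lmax
        have h2 := integral_wasserstein_le hp hS (hY i) hs (hYlaw i) (hindY i) hq lmax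
        linarith
    _ = _ := by simp [hB0.ne']

/-- Independence, expressed by the joint weights. -/
theorem measureReal_fiber_eq_prodWeight {ι α : Type*} [Fintype ι] [Fintype α]
    [MeasurableSpace α] [MeasurableSingletonClass α] {V : ι → Ω → α} {v : ι → α → ℝ}
    (hind : iIndepFun V P) (hlaw : ∀ k x, P.real (V k ⁻¹' {x}) = v k x) (u : ι → α) :
    P.real ((fun ω k => V k ω) ⁻¹' {u}) = prodWeight v u := by
  have h1 : (fun ω k => V k ω) ⁻¹' {u} = ⋂ k, V k ⁻¹' {u k} := by
    ext ω; simp [funext_iff]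
  rw [h1, measureReal_def, hind.meas_iInter fun k => ⟨{u k}, measurableSet_singleton _, rfl⟩,
    ENNReal.toReal_prod]
  exact Finset.prod_congr rfl fun k _ => hlaw k (u k)

end

end FiniteOT

end

theorem theorem4 {𝒳 : Type*} [Fintype 𝒳] [MetricSpace 𝒳]
    [MeasurableSpace 𝒳] [MeasurableSingletonClass 𝒳]
    {Ω : Type*} [MeasurableSpace Ω] (P : Measure Ω) [IsProbabilityMeasure P]
    (p : ℝ) (hp : 1 ≤ p)
    (r s : 𝒳 → ℝ) (hr : r ∈ stdSimplex ℝ 𝒳) (hs : s ∈ stdSimplex ℝ 𝒳)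
    (S B : ℕ) (hS : 1 ≤ S) (hB : 1 ≤ B)
    (X Y : Fin B → Fin S → Ω → 𝒳)
    (hX : ∀ i j, Measurable (X i j)) (hY : ∀ i j, Measurable (Y i j))
    (hXlaw : ∀ i j x, P.real (X i j ⁻¹' {x}) = r x)
    (hYlaw : ∀ i j x, P.real (Y i j ⁻¹' {x}) = s x)
    (hindep : iIndepFun
      (Sum.elim (fun k : Fin B × Fin S => X k.1 k.2) (fun k : Fin B × Fin S => Y k.1 k.2)) P)
    (q : ℕ) (hq : 2 ≤ q) (lmax : ℕ) (z : ℝ) (hz : 0 ≤ z) :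
    P.real {ω |
        z + 2 * FiniteOT.errorConst 𝒳 p q lmax ^ (1 / p) * (S : ℝ) ^ (-(1 / (2 * p))) ≤
          |FiniteOT.subsampledWasserstein p (fun i j => X i j ω) (fun i j => Y i j ω)
            - FiniteOT.wasserstein p r s|} ≤
      2 * Real.exp (-((S : ℝ) * B * z ^ (2 * p)) /
        (8 * Metric.diam (Set.univ : Set 𝒳) ^ (2 * p))) := by
  classical
  set D := Metric.diam (Set.univ : Set 𝒳)
  have hD0 : 0 ≤ D := Metric.diam_nonneg
  rcases hD0.eq_or_lt with hD | hD
  · -- for a one-point space the exponent is `0`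
    rw [← hD, Real.zero_rpow (by positivity), mul_zero, div_zero, Real.exp_zero]
    exact measureReal_le_one.trans (by norm_num)
  have hB0 : (0 : ℝ) < B := by positivity
  have hS0 : (0 : ℝ) < S := by positivity
  have hSne : Nonempty (Fin S) := ⟨⟨0, hS⟩⟩
  have hBne : Nonempty (Fin B) := ⟨⟨0, hB⟩⟩
  let ι := (Fin B × Fin S) ⊕ (Fin B × Fin S)
  let V : ι → Ω → 𝒳 :=
    Sum.elim (fun k : Fin B × Fin S => X k.1 k.2) (fun k : Fin B × Fin S => Y k.1 k.2)
  let v : ι → 𝒳 → ℝ := Sum.elim (fun _ => r) (fun _ => s)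
  have hv : ∀ k, v k ∈ stdSimplex ℝ 𝒳 := by rintro (k | k) <;> assumption
  have hV : ∀ k, Measurable (V k) := by
    rintro (k | k)
    · exact hX _ _
    · exact hY _ _
  have hlaw : ∀ k x, P.real (V k ⁻¹' {x}) = v k x := by
    rintro (k | k) x
    · exact hXlaw _ _ x
    · exact hYlaw _ _ x
  have hU : Measurable fun ω k => V k ω := measurable_pi_lambda _ hV
  have hfib := FiniteOT.measureReal_fiber_eq_prodWeight (v := v) hindep hlaw
  let T : (ι → 𝒳) → ℝ := fun u => |FiniteOT.subsampledJoint p u - FiniteOT.wasserstein p r s|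
  set m := 2 * FiniteOT.errorConst 𝒳 p q lmax ^ (1 / p) * (S : ℝ) ^ (-(1 / (2 * p))) with hm
  let A : Finset (ι → 𝒳) := Finset.univ.filter fun u => z + m ≤ T u
  have hevent : {ω | z + m ≤ |FiniteOT.subsampledWasserstein p (fun i j => X i j ω)
      (fun i j => Y i j ω) - FiniteOT.wasserstein p r s|} = (fun ω k => V k ω) ⁻¹' (A : Set _) := by
    ext ω
    simp only [A, Set.mem_preimage, Finset.coe_filter, Finset.mem_univ, true_and]
    rfl
  rw [hevent, ← sum_measureReal_preimage_singleton A fun u _ => hU (measurableSet_singleton u)]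
  have hsum : ∑ u ∈ A, P.real ((fun ω k => V k ω) ⁻¹' {u}) =
      ∑ u ∈ A, FiniteOT.prodWeight v u := Finset.sum_congr rfl fun u _ => hfib u
  rw [hsum]
  have hT : ∀ u u', T u ≤ T u' + D * (FiniteOT.ham u' u / (S * B)) ^ (1 / p) := by
    intro u u'
    have h1 := FiniteOT.abs_subsampledJoint_sub_le hp hS hB u' u
    have h2 := abs_sub_abs_le_abs_sub (FiniteOT.subsampledJoint p u - FiniteOT.wasserstein p r s)
      (FiniteOT.subsampledJoint p u' - FiniteOT.wasserstein p r s)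
    rw [sub_sub_sub_cancel_right, abs_sub_comm (FiniteOT.subsampledJoint p u)
      (FiniteOT.subsampledJoint p u')] at h2
    simp only [T]
    linarith
  have hindX : ∀ i, iIndepFun (X i) P := fun i =>
    hindep.precomp (g := fun j => Sum.inl (i, j)) fun j j' h => by simpa using h
  have hindY : ∀ i, iIndepFun (Y i) P := fun i =>
    hindep.precomp (g := fun j => Sum.inr (i, j)) fun j j' h => by simpa using h
  have hmean : ∑ u, FiniteOT.prodWeight v u * T u ≤ m := by
    refine Eq.trans_le ?_ (FiniteOT.integral_abs_subsampled_sub_le hp hr hs hS hB hX hY hXlaw hYlaw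
      hindX hindY hq lmax)
    refine Eq.trans ?_ (FiniteOT.integral_comp_eq_sum hU T).symm
    exact Finset.sum_congr rfl fun u _ => by rw [← hfib u]
  refine (FiniteOT.sum_prodWeight_le_of_holder hv hp hD (mul_pos hS0 hB0) hT hmean hz
    (A := A) fun u hu => (Finset.mem_filter.1 hu).2).trans ?_
  refine (Real.exp_le_exp.2 ?_).trans (le_mul_of_one_le_left (Real.exp_nonneg _) one_le_two)
  have hcard : (Fintype.card ι : ℝ) = 2 * (S * B) := by
    simp [ι]; ring
  rw [hcard, neg_div]
  refine neg_le_neg ?_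
  have hQ : 0 ≤ S * B * (z ^ (2 * p) / D ^ (2 * p)) := by positivity
  have e1 : (S : ℝ) * B * z ^ (2 * p) / (8 * D ^ (2 * p)) =
      S * B * (z ^ (2 * p) / D ^ (2 * p)) / 8 := by
    field_simp
  have e2 : ((S : ℝ) * B) ^ 2 * (z ^ (2 * p) / D ^ (2 * p)) / (2 * (2 * (S * B))) =
      S * B * (z ^ (2 * p) / D ^ (2 * p)) / 4 := by
    field_simp; ring
  rw [e1, e2]
  linarith
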